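/- Let $K$ be a field of characteristic $0$ and $\alpha\in K$. Write $K\{u\}=K[u,u^{(1)},u^{(2)},\dots]$ and $K\{u,\varphi\}$ for the rings of differential polynomials, $\partial=d/dx$ for the total derivative, and $F\sim G$ if $F-G$ is a total derivative. An evolution system $u_t=G,\ \varphi_t=F$ is identified with the derivation of $K\{u,\varphi\}$ that commutes with $\partial$ and sends $u\mapsto G$, $\varphi\mapsto F$; two systems commute if these derivations do. (0) There is exactly one sequence $h_n\in K\{u\}$, $n\ge 0$, with $h_0=\tfrac12$, $(\partial^3+2u\partial+2\partial u)(h_n)=\partial(h_{n+1})$ for all $n\ge 0$, and $h_n$ without constant term for $n\ge 1$ (so $h_1=u$, $h_2=u_{xx}+3u^2$, ...). The KdV flows are $X_n:\ u_t=\partial(h_n)$, $n\ge1$. Their extensions are $$X_n^{\rm ext}:\quad u_t=\partial(h_n),\qquad \varphi_t=A_n(\varphi),\qquad A_n=\alpha h_{n-1,x}+2h_{n-1}\partial ;$$ in particular $X_2^{\rm ext}$ is $u_t=\partial(3u^2+u_{xx})$, $\varphi_t=(\alpha u_x+2u\partial)(\varphi)$. (1) All the flows $X_n^{\rm ext}$,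 $n\ge 1$, commute with each other. (2) There are $H_n\in K\{u\}$, $n\ge0$, with $h_n=\delta H_n/\delta u$, which are in involution, modulo total derivatives, in the second Hamiltonian structure $2(u\partial+\partial u+\partial^3/2)$ of KdV, and $X_n^{\rm ext}$ is the system $(u,\varphi)^t_t=B\,(\delta H_{n-1}/\delta u,\ \delta H_{n-1}/\delta\varphi)^t$ with $$B=2\begin{pmatrix}u\partial+\partial u+\partial^3/2 & -\varphi_x+\frac{\alpha}{2}\partial\varphi\\ \varphi_x+\frac{\alpha}{2}\varphi\partial & 0\end{pmatrix}.$$ (3) Let $(k,\,')$ be any commutative $K$-algebra with a $K$-linear derivation, and let differential polynomials now have coefficients in $k$, with $\partial$ extending $'$. Then $B$ is a Hamiltonian matrix: it is skew-adjoint; the bracket $\{H,F\}=X_H(F)$, where $X_H$ is the evolution derivation $q_t=B(\delta H/\delta q)$, $q=(u,\varphi)^t$, satisfies the Jacobi identity modulo total derivatives; and $[X_H,X_F]=X_{\{H,F\}}$ for all $H,F$. Moreover, with $\lambda=1-\alpha/2$, $$\tfrac12B=B_\lambda+b,\qquad B_\lambda=\begin{pmatrix}u\partial+\partial u & \varphi\partial-\lambda\partial\varphi\\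 \partial\varphi-\lambda\varphi\partial&0\end{pmatrix},\qquad b=\begin{pmatrix}\partial^3/2&0\\0&0\end{pmatrix}.$$ The linear part $B_\lambda$ corresponds, via $\xi^tB_\lambda(\eta)\sim q^t[\xi,\eta]$, to the semidirect sum $\mathcal D_1\ltimes V^\lambda$ of the Lie algebra $\mathcal D_1$ of vector fields $X\partial$, $X\in k$, $[X\partial,Y\partial]=(XY'-X'Y)\partial$, and its module $V^\lambda$ of $\lambda$-forms $f(dx)^\lambda$, $f\in k$, with action $X\partial\cdot f(dx)^\lambda=(Xf'+\lambda X'f)(dx)^\lambda$. The constant part $b$ is given by the bilinear form $\omega(X\partial,Y\partial)=\tfrac12XY'''$, which is a generalized $2$-cocycle on $\mathcal D_1$: it is skew and satisfies the $2$-cocycle identity modulo the image of $'$. (4) These flows exhaust the centralizer of $X_2^{\rm ext}$ among linear scalar extensions of KdV flows. Let $c_n\in K$, $n\ge1$, with almost all $c_n=0$. (a) If $R=\sum_s f_s\partial^s$ is a differential operator with $f_s\in K\{u\}$, then $u_t=\sum_n c_n\partial(h_n),\ \varphi_t=R(\varphi)$ commutes with $X_2^{\rm ext}$ if and only if $R=\sum_n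 c_nA_n+c_0$ for some constant $c_0\in K$. (b) Give $u^{(i)}$ rank $i+2$ and $\partial$ rank $1$, and for each $n$ with $c_n\neq 0$ let $R_n$ be a differential operator with coefficients in $K\{u\}$, homogeneous of rank $2n-1$. Then $u_t=\sum_n c_n\partial(h_n),\ \varphi_t=\sum_{n:\,c_n\ne0}R_n(\varphi)$ commutes with $X_2^{\rm ext}$ if and only if $R_n=c_nA_n$ for every $n$ with $c_n\ne 0$. In particular, if $R$ is homogeneous of rank $2n-1$, the system $u_t=\partial(h_n),\ \varphi_t=R(\varphi)$ commutes with $X_2^{\rm ext}$ if and only if it is $X_n^{\rm ext}$. -/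

import Mathlib

open scoped BigOperators

noncomputable section

namespace KdVExt

/-! ### Differential polynomials

Coefficients are taken in a commutative `K`-algebra `k` with a `K`-linear derivation `d`
(for instance functions of `x` with `d = d/dx`, or `k = K` with `d = 0`). -/

section Jets

/-- Differential polynomials over `k` in the fields `q i`, `i : ι`. The variable `X (i, n)` is the
`n`-th `x`-derivative of the field `q i`. -/
abbrev Jet (k : Type*) [CommRing k] (ι : Type*) : Type _ := MvPolynomial (ι × ℕ) k

variable {K k ι : Type*} [CommRing K] [CommRing k] [Algebra K k]

/-- Apply the derivation `d` to all coefficients of a polynomial. -/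
def coeffDeriv (σ : Type*) (d : Derivation K k k) :
    Derivation K (MvPolynomial σ k) (MvPolynomial σ k) :=
  Derivation.mk'
    { toFun := AddMonoidAlgebra.map (d : k →+ k)
      map_add' := fun x y => by ext; simp
      map_smul' := fun c x => by ext; simp }
    (fun x y => by
      induction x using MvPolynomial.induction_on' with
      | add x₁ x₂ h₁ h₂ =>
        rw [add_mul, map_add, h₁, h₂, map_add, smul_add, add_smul]; abel
      | monomial s a =>
        induction y using MvPolynomial.induction_on' with
        | add y₁ y₂ h₁ h₂ =>
          rw [mul_add, map_add, h₁, h₂, map_add, smul_add, add_smul]; abel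
        | monomial t b =>
          have key : ∀ (s : σ →₀ ℕ) (a : k),
              AddMonoidAlgebra.map (d : k →+ k) (MvPolynomial.monomial s a)
                = MvPolynomial.monomial s (d a) := fun s a => by
            simp only [← MvPolynomial.single_eq_monomial, AddMonoidAlgebra.map_single]
            rfl
          simp only [LinearMap.coe_mk, AddHom.coe_mk, MvPolynomial.monomial_mul, key,
            smul_eq_mul, Derivation.leibniz, map_add]
          rw [add_comm t s, mul_comm b])

/-- The total `x`-derivative `∂`: it acts as `d` on coefficients and maps `q_i^{(n)}` to
`q_i^{(n+1)}`. -/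
def totalDeriv (d : Derivation K k k) : Derivation K (Jet k ι) (Jet k ι) :=
  coeffDeriv (ι × ℕ) d +
    (MvPolynomial.mkDerivation k
      (fun p : ι × ℕ => (MvPolynomial.X (p.1, p.2 + 1) : Jet k ι))).restrictScalars K

/-- The evolution derivation `q_i ↦ P i`, i.e. the flow `∂q_i/∂t = P i`: it is trivial on
coefficients and commutes with `∂`. -/
def evol (d : Derivation K k k) (P : ι → Jet k ι) : Derivation k (Jet k ι) (Jet k ι) :=
  MvPolynomial.mkDerivation k (fun p : ι × ℕ => (totalDeriv d)^[p.2] (P p.1))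

/-- The variational derivative `δH/δq_i = ∑_n (-∂)^n (∂H/∂q_i^{(n)})`. -/
def varDeriv (d : Derivation K k k) (H : Jet k ι) (i : ι) : Jet k ι :=
  ∑ᶠ n : ℕ, (-1) ^ n * (totalDeriv d)^[n] (MvPolynomial.pderiv (i, n) H)

/-- Equality modulo trivial elements (total derivatives). -/
def EqModDiv (d : Derivation K k k) (F G : Jet k ι) : Prop :=
  ∃ E : Jet k ι, F - G = totalDeriv d E

/-! ### Matrix operators and Hamiltonian matrices -/

/-- The operator of multiplication by `f`. -/
def mulOp (f : Jet k ι) : Module.End K (Jet k ι) := LinearMap.mulLeft K f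

/-- `∂` as an operator. -/
def dOp (d : Derivation K k k) : Module.End K (Jet k ι) := (totalDeriv d).toLinearMap

/-- The action of a matrix of operators on a vector. -/
def matApply {m n : Type*} [Fintype n] (B : Matrix m n (Module.End K (Jet k ι)))
    (P : n → Jet k ι) : m → Jet k ι :=
  fun i => ∑ j, B i j (P j)

variable [Fintype ι]

/-- The evolution field `q_t = B (δH/δq)`. -/
def hamField (d : Derivation K k k) (B : Matrix ι ι (Module.End K (Jet k ι)))
    (H : Jet k ι) : Derivation k (Jet k ι) (Jet k ι) :=
  evol d (matApply B (varDeriv d H))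

/-- The Poisson bracket `{H, F} = X_H(F)`, a Lie bracket modulo total derivatives when `B` is
Hamiltonian. -/
def bracket (d : Derivation K k k) (B : Matrix ι ι (Module.End K (Jet k ι)))
    (H F : Jet k ι) : Jet k ι :=
  hamField d B H F

/-- `B` is Hamiltonian: it is skew-adjoint, its Poisson bracket satisfies the Jacobi identity
modulo total derivatives, and `H ↦ X_H` maps Poisson brackets to commutators. -/
structure IsHamiltonian (d : Derivation K k k) (B : Matrix ι ι (Module.End K (Jet k ι))) :
    Prop where
  skew : ∀ P Q : ι → Jet k ι,
    EqModDiv d (∑ i, P i * matApply B Q i) (-∑ i, Q i * matApply B P i)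
  jacobi : ∀ H F G : Jet k ι,
    EqModDiv d (bracket d B H (bracket d B F G) + bracket d B F (bracket d B G H)
      + bracket d B G (bracket d B H F)) 0
  commutator : ∀ H F : Jet k ι,
    ⁅hamField d B H, hamField d B F⁆ = hamField d B (bracket d B H F)

end Jets

/-! ### The matrices on the fields `u = q 0`, `φ = q 1` -/

section Matrices

variable {K k : Type*} [Field K] [CommRing k] [Algebra K k]

/-- The matrix
`2 [[u∂ + ∂u + ∂³/2, -φ_x + (α/2)∂φ], [φ_x + (α/2)φ∂, 0]]`. -/
def extMatrix (d : Derivation K k k) (α : K) :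
    Matrix (Fin 2) (Fin 2) (Module.End K (Jet k (Fin 2))) :=
  let D : Module.End K (Jet k (Fin 2)) := dOp d
  let u : Module.End K (Jet k (Fin 2)) := mulOp (MvPolynomial.X (0, 0))
  let φ : Module.End K (Jet k (Fin 2)) := mulOp (MvPolynomial.X (1, 0))
  let φx : Module.End K (Jet k (Fin 2)) := mulOp (MvPolynomial.X (1, 1))
  (2 : K) • !![u * D + D * u + (1 / 2 : K) • D ^ 3, -φx + (α / 2) • (D * φ);
               φx + (α / 2) • (φ * D), 0]

/-- The linear matrix `[[u∂ + ∂u, φ∂ - λ∂φ], [∂φ - λφ∂, 0]]`. -/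
def linMatrix (d : Derivation K k k) (lam : K) :
    Matrix (Fin 2) (Fin 2) (Module.End K (Jet k (Fin 2))) :=
  let D : Module.End K (Jet k (Fin 2)) := dOp d
  let u : Module.End K (Jet k (Fin 2)) := mulOp (MvPolynomial.X (0, 0))
  let φ : Module.End K (Jet k (Fin 2)) := mulOp (MvPolynomial.X (1, 0))
  !![u * D + D * u, φ * D - lam • (D * φ);
     D * φ - lam • (φ * D), 0]

/-- The constant matrix `[[∂³/2, 0], [0, 0]]`. -/
def constMatrix (d : Derivation K k k) :
    Matrix (Fin 2) (Fin 2) (Module.End K (Jet k (Fin 2))) :=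
  !![(1 / 2 : K) • dOp d ^ 3, 0; 0, 0]

/-- The second Hamiltonian structure `2 (u∂ + ∂u + ∂³/2)` of the KdV hierarchy, as a 1 by 1 matrix
on the single field `u = q 0`. -/
def kdvMatrix (d : Derivation K k k) :
    Matrix (Fin 1) (Fin 1) (Module.End K (Jet k (Fin 1))) :=
  let D : Module.End K (Jet k (Fin 1)) := dOp d
  let u : Module.End K (Jet k (Fin 1)) := mulOp (MvPolynomial.X (0, 0))
  !![(2 : K) • (u * D + D * u + (1 / 2 : K) • D ^ 3)]

end Matrices

/-! ### The Lie algebra `D₁ ⋉ V^λ` -/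

section LieAlgebra

variable {K k : Type*} [Field K] [CommRing k] [Algebra K k]

/-- The Lie algebra `D₁` of vector fields `X ∂`, `X ∈ k`, with `[X∂, Y∂] = (X Y' - X' Y)∂`,
where `' = d`. -/
def VectField (_d : Derivation K k k) : Type _ := k

/-- The space `V^λ` of `λ`-forms `f (dx)^λ`, `f ∈ k`. -/
def Density (_d : Derivation K k k) (_lam : K) : Type _ := k

variable (d : Derivation K k k) (lam : K)

instance : AddCommGroup (VectField d) := inferInstanceAs (AddCommGroup k)
instance : Module K (VectField d) := inferInstanceAs (Module K k)
instance : AddCommGroup (Density d lam) := inferInstanceAs (AddCommGroup k)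
instance : Module K (Density d lam) := inferInstanceAs (Module K k)

/-- The vector field with the given coefficient. -/
def VectField.of : k ≃ₗ[K] VectField d := LinearEquiv.refl K k

/-- The `λ`-form with the given coefficient. -/
def Density.of : k ≃ₗ[K] Density d lam := LinearEquiv.refl K k

variable {d} in
/-- The coefficient of a vector field. -/
abbrev VectField.val (X : VectField d) : k := (VectField.of d).symm X

variable {d lam} in
/-- The coefficient of a `λ`-form. -/
abbrev Density.val (f : Density d lam) : k := (Density.of d lam).symm f

instance : Bracket (VectField d) (VectField d) :=
  ⟨fun X Y => VectField.of d (X.val * d Y.val - d X.val * Y.val)⟩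

theorem VectField.val_lie (X Y : VectField d) :
    (⁅X, Y⁆ : VectField d).val = X.val * d Y.val - d X.val * Y.val := rfl

instance : LieRing (VectField d) where
  add_lie X Y Z := by
    apply (VectField.of d).symm.injective
    simp only [VectField.val_lie, map_add]
    ring
  lie_add X Y Z := by
    apply (VectField.of d).symm.injective
    simp only [VectField.val_lie, map_add]
    ring
  lie_self X := by
    apply (VectField.of d).symm.injective
    simp only [VectField.val_lie, map_zero]
    ring
  leibniz_lie X Y Z := by
    apply (VectField.of d).symm.injective
    simp only [VectField.val_lie, map_add, map_sub, Derivation.leibniz, smul_eq_mul]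
    ring

instance : LieAlgebra K (VectField d) where
  lie_smul c X Y := by
    apply (VectField.of d).symm.injective
    simp only [VectField.val_lie, map_smul]
    simp only [VectField.val, Derivation.map_smul, Algebra.mul_smul_comm, smul_sub]

/-- `V^λ` is viewed as an abelian Lie algebra. -/
instance : Bracket (Density d lam) (Density d lam) := ⟨fun _ _ => 0⟩

instance : LieRing (Density d lam) where
  add_lie _ _ _ := (add_zero 0).symm
  lie_add _ _ _ := (add_zero 0).symm
  lie_self _ := rfl
  leibniz_lie _ _ _ := (add_zero 0).symm

instance : LieAlgebra K (Density d lam) where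
  lie_smul c _ _ := (smul_zero c).symm

theorem Density.lie_eq_zero (f g : Density d lam) : ⁅f, g⁆ = 0 := rfl

/-- The action of `D₁` on `λ`-forms by Lie derivatives,
`X∂ · f (dx)^λ = (X f' + λ X' f) (dx)^λ`. -/
def lieDer : VectField d →ₗ⁅K⁆ LieDerivation K (Density d lam) (Density d lam) where
  toFun X :=
    { toFun := fun f => Density.of d lam (X.val * d f.val + lam • (d X.val * f.val))
      map_add' := fun f g => by
        apply (Density.of d lam).symm.injective
        simp only [map_add, LinearEquiv.symm_apply_apply, mul_add, smul_add]
        abel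
      map_smul' := fun c f => by
        apply (Density.of d lam).symm.injective
        simp only [Density.val, map_smul, LinearEquiv.symm_apply_apply, RingHom.id_apply]
        simp only [Derivation.map_smul, Algebra.mul_smul_comm, smul_add, smul_comm lam c]
      leibniz' := fun f g => by
        apply (Density.of d lam).symm.injective
        simp [Density.lie_eq_zero] }
  map_add' X Y := by
    ext f
    apply (Density.of d lam).symm.injective
    change (X + Y).val * d f.val + lam • (d (X + Y).val * f.val) =
      (X.val * d f.val + lam • (d X.val * f.val)) + (Y.val * d f.val + lam • (d Y.val * f.val))
    simp only [map_add, add_mul, smul_add]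
    abel
  map_smul' c X := by
    ext f
    apply (Density.of d lam).symm.injective
    change (c • X).val * d f.val + lam • (d (c • X).val * f.val) =
      c • (X.val * d f.val + lam • (d X.val * f.val))
    simp only [VectField.val, map_smul]
    simp only [Derivation.map_smul, Algebra.smul_mul_assoc, smul_add, smul_comm lam c]
  map_lie' {X Y} := by
    ext f
    apply (Density.of d lam).symm.injective
    rw [LieDerivation.commutator_apply]
    change (X.val * d Y.val - d X.val * Y.val) * d f.val
        + lam • (d (X.val * d Y.val - d X.val * Y.val) * f.val) =
      (X.val * d (Y.val * d f.val + lam • (d Y.val * f.val))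
        + lam • (d X.val * (Y.val * d f.val + lam • (d Y.val * f.val))))
      - (Y.val * d (X.val * d f.val + lam • (d X.val * f.val))
        + lam • (d Y.val * (X.val * d f.val + lam • (d X.val * f.val))))
    simp only [map_add, map_sub, Derivation.leibniz, smul_eq_mul, Algebra.smul_def,
      Derivation.map_algebraMap]
    ring

/-- The semidirect sum `D₁ ⋉ V^λ`. -/
abbrev SemiDir : Type _ := LieAlgebra.SemiDirectSum (Density d lam) (VectField d) (lieDer d lam)

variable {d lam} in
/-- The pair of coefficients of `X∂ + f (dx)^λ`, as a vector of (constant) differential polynomials: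
`X` is paired with `u`, and `f` with `φ`. -/
def coords (x : SemiDir d lam) : Fin 2 → Jet k (Fin 2) :=
  ![MvPolynomial.C x.right.val, MvPolynomial.C x.left.val]

/-- The linear matrix `B` corresponds to the Lie algebra `D₁ ⋉ V^λ`: `X^t B(Y) ∼ q^t [X, Y]`. -/
def CorrespondsToSemiDir (B : Matrix (Fin 2) (Fin 2) (Module.End K (Jet k (Fin 2)))) : Prop :=
  ∀ x y : SemiDir d lam,
    EqModDiv d (∑ i, coords x i * matApply B (coords y) i)
      (∑ i, MvPolynomial.X (i, 0) * coords ⁅x, y⁆ i)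

/-- A generalized 2-cocycle on a Lie algebra `L`: a bilinear form with values in `k` which is skew
and satisfies the cocycle identity modulo the image of `d`. -/
def IsGenCocycle {L : Type*} [LieRing L] [LieAlgebra K L] (ω : L →ₗ[K] L →ₗ[K] k) : Prop :=
  (∀ x y, ∃ e : k, ω x y + ω y x = d e) ∧
    ∀ x y z, ∃ e : k, ω ⁅x, y⁆ z + ω ⁅y, z⁆ x + ω ⁅z, x⁆ y = d e

/-- The bilinear form `(X∂, Y∂) ↦ X Y'''/2` on `D₁`. -/
def gfForm : VectField d →ₗ[K] VectField d →ₗ[K] k :=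
  (1 / 2 : K) • (LinearMap.mul K k).compl₁₂ (VectField.of d).symm.toLinearMap
    ((d.toLinearMap ^ 3 : Module.End K k) ∘ₗ (VectField.of d).symm.toLinearMap)

end LieAlgebra

/-! ### The KdV hierarchy and its linear extensions -/

section Hierarchy

variable {K : Type*} [Field K]

/-- `∂` on differential polynomials with constant coefficients. -/
abbrev D (ι : Type*) : Derivation K (Jet K ι) (Jet K ι) := totalDeriv (0 : Derivation K K K)

/-- The differential polynomials `h_n` of the KdV hierarchy: `h_0 = 1/2`,
`(∂³ + 2u∂ + 2∂u)(h_n) = ∂ h_{n+1}`, and no `h_n` with `n ≥ 1` has a constant term. -/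
structure IsKdVSequence (h : ℕ → Jet K (Fin 1)) : Prop where
  init : h 0 = MvPolynomial.C (1 / 2)
  recursion : ∀ n,
    let u : Jet K (Fin 1) := MvPolynomial.X (0, 0)
    D (Fin 1) (D (Fin 1) (D (Fin 1) (h n))) + 2 * u * D (Fin 1) (h n) + 2 * D (Fin 1) (u * h n)
      = D (Fin 1) (h (n + 1))
  normalized : ∀ n, MvPolynomial.constantCoeff (h (n + 1)) = 0

/-- A differential polynomial in `u` regarded as one in `u` and `φ`. -/
def inclU : Jet K (Fin 1) →ₐ[K] Jet K (Fin 2) :=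
  MvPolynomial.rename (fun p : Fin 1 × ℕ => ((0 : Fin 2), p.2))

/-- Formal differential operators `∑_s f_s ∂^s` (finite sums) whose coefficients are differential
polynomials in `u`: the operator is recorded as `s ↦ f_s`. -/
abbrev DiffOp (K : Type*) [Field K] : Type _ := ℕ →₀ Jet K (Fin 1)

/-- `R(φ) = ∑_s f_s φ^{(s)}`. -/
def applyPhi (R : DiffOp K) : Jet K (Fin 2) :=
  R.sum fun s f => inclU f * MvPolynomial.X (1, s)

/-- The linear extension `u_t = G`, `φ_t = R(φ)`. -/
def linExt (G : Jet K (Fin 1)) (R : DiffOp K) :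
    Derivation K (Jet K (Fin 2)) (Jet K (Fin 2)) :=
  evol (0 : Derivation K K K) ![inclU G, applyPhi R]

/-- The operator `α h_x + 2 h ∂`. -/
def firstOrderOp (α : K) (h : Jet K (Fin 1)) : DiffOp K :=
  Finsupp.single 0 (α • D (Fin 1) h) + Finsupp.single 1 (2 * h)

/-- The extended KdV field `X_{n+1}^ext`:
`u_t = ∂ h_{n+1}`, `φ_t = (α h_{n,x} + 2 h_n ∂)(φ)`. -/
def extKdV (α : K) (h : ℕ → Jet K (Fin 1)) (n : ℕ) :
    Derivation K (Jet K (Fin 2)) (Jet K (Fin 2)) :=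
  linExt (D (Fin 1) (h (n + 1))) (firstOrderOp α (h n))

/-- The field `X_2^ext`: `u_t = ∂(3u² + u_xx)`, `φ_t = (α u_x + 2u∂)(φ)`. -/
def extKdV₂ (α : K) : Derivation K (Jet K (Fin 2)) (Jet K (Fin 2)) :=
  linExt (D (Fin 1) (3 * MvPolynomial.X (0, 0) ^ 2 + MvPolynomial.X (0, 2)))
    (firstOrderOp α (MvPolynomial.X (0, 0)))

/-- `R` is homogeneous of rank `r`, where `rk u^{(i)} = i + 2` and `rk ∂ = 1`. -/
def HasRank (R : DiffOp K) (r : ℕ) : Prop :=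
  ∀ (s : ℕ) (m : Fin 1 × ℕ →₀ ℕ), MvPolynomial.coeff m (R s) ≠ 0 →
    Finsupp.weight (fun p : Fin 1 × ℕ => p.2 + 2) m + s = r

end Hierarchy

end KdVExt

end

/-! Write `L_G(f)` for `adjFrechet d i G f`, the adjoint Fréchet derivative of `G` applied to `f`,
so that `δG = L_G(1)`. As a function of `G` it satisfies `L_{GG'}(f) = L_G(G'f) + L_{G'}(Gf)` and
`L_{∂G}(f) = L_G(-∂f)`. These two rules replace explicit sums almost everywhere.

Hamiltonian property. For `P = δH` and `Q = δF`, self-adjointness of the Fréchet derivative of a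
variational derivative (`evol_varDeriv`) and skew-adjointness of `B` give `δ{H,F} = X_H(Q) - X_F(P)
+ T(P,Q)`. Here `T` (`extTorsion`) comes only from the explicit dependence of `B` on the fields. So
`[X_H, X_F] = X_{{H,F}}` reduces to a polynomial identity for `B T(P,Q)` (`extMatrix_torsion`),
valid for all vectors `P`, `Q`. The Jacobi identity then follows from skewness.

Hierarchy. Put `P = ∂³ + 2u∂ + 2∂u` and `h(z) = ∑ h_n zⁿ`; the recursion reads `∂h = z P h`. Since
`h P h` is a total derivative, it integrates to `4(z(2hh'' - h'² + 4uh²) - h²) = -1`. Read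
coefficientwise, this defines `h_{n+1}` polynomially from its predecessors; uniqueness holds because
the kernel of `∂` is the constants. Testing the quadratic relation against `g = 1/h` gives `δg/δu =
-8zh`, and modulo total derivatives `4h - g + 2z∂_z g ∼ 0`. Together they give `δh_{n+1}/δu =
(4n+2)h_n`, hence `H_n = h_{n+1}/(4n+2)`.

Commutation. The Lenard scheme makes the `H_n` commute for KdV. The extended flows have the same
Hamiltonians, so their commutators are Hamiltonian fields of total derivatives and vanish.

Centralizer. After subtracting `∑ c_n A_n`, the `u`-component is zero and the remaining operator `S`
must commute with the evolution. Its leading coefficient satisfies a linear equation that the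
third-order KdV flow forces to have only constant solutions; then `S` has order zero
(`lie_extKdV₂_linExt_zero`). Comparing ranks removes the last constant. -/

namespace KdVExt

open MvPolynomial
open Finset.HasAntidiagonal (antidiagonal mem_antidiagonal)

/-! ### Variational calculus: evolution fields and adjoint Fréchet derivatives -/

section Calculus

variable {K k ι : Type*} [CommRing K] [CommRing k] [Algebra K k] (d : Derivation K k k)

theorem totalDeriv_C (a : k) : totalDeriv d (C a : Jet k ι) = C (d a) := by
  have : coeffDeriv (ι × ℕ) d (C a) = C (d a) := by
    change AddMonoidAlgebra.map (d : k →+ k) (monomial 0 a) = monomial 0 (d a)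
    simp only [← MvPolynomial.single_eq_monomial, AddMonoidAlgebra.map_single]
    rfl
  simp [totalDeriv, this]

@[simp]
theorem totalDeriv_X (p : ι × ℕ) : totalDeriv d (X p : Jet k ι) = X (p.1, p.2 + 1) := by
  have : coeffDeriv (ι × ℕ) d (X p) = 0 := by
    change AddMonoidAlgebra.map (d : k →+ k) (monomial _ 1) = 0
    simp only [← MvPolynomial.single_eq_monomial, AddMonoidAlgebra.map_single]
    change AddMonoidAlgebra.single _ (d 1) = 0
    simp
  simp [totalDeriv, this]

@[simp]
theorem totalDeriv_algebraMap (c : K) : totalDeriv d (algebraMap K (Jet k ι) c) = 0 :=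
  (totalDeriv d).map_algebraMap c

theorem evol_X (P : ι → Jet k ι) (i : ι) (n : ℕ) :
    evol d P (X (i, n)) = (totalDeriv d)^[n] (P i) :=
  mkDerivation_X _ _ _

@[simp]
theorem evol_X_zero (P : ι → Jet k ι) (i : ι) : evol d P (X (i, 0)) = P i :=
  evol_X d P i 0

@[simp]
theorem evol_X_one (P : ι → Jet k ι) (i : ι) :
    evol d P (X (i, 1)) = totalDeriv d (P i) :=
  evol_X d P i 1

theorem evol_algebraMap (P : ι → Jet k ι) (c : K) : evol d P (algebraMap K (Jet k ι) c) = 0 := by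
  rw [IsScalarTower.algebraMap_apply K k (Jet k ι)]
  exact derivation_C _ _

theorem evol_totalDeriv (P : ι → Jet k ι) (F : Jet k ι) :
    evol d P (totalDeriv d F) = totalDeriv d (evol d P F) := by
  induction F using MvPolynomial.induction_on with
  | C a => simp [totalDeriv_C]
  | add p q hp hq => simp [hp, hq]
  | mul_X p n hp =>
    obtain ⟨i, n⟩ := n
    simp only [Derivation.leibniz, map_add, smul_eq_mul, totalDeriv_X, hp, evol_X,
      Function.iterate_succ_apply']
    ring

theorem evol_iterate_totalDeriv (P : ι → Jet k ι) (n : ℕ) (F : Jet k ι) :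
    evol d P ((totalDeriv d)^[n] F) = (totalDeriv d)^[n] (evol d P F) := by
  induction n with
  | zero => rfl
  | succ n ih => rw [Function.iterate_succ_apply', evol_totalDeriv, ih,
      Function.iterate_succ_apply']

theorem lie_evol (P Q : ι → Jet k ι) :
    ⁅evol d P, evol d Q⁆ = evol d (fun i => evol d P (Q i) - evol d Q (P i)) := by
  refine derivation_ext fun p => ?_
  rw [Derivation.commutator_apply, evol_X, evol_X, evol_X, evol_iterate_totalDeriv,
    evol_iterate_totalDeriv, iterate_map_sub]

theorem evol_add (P Q : ι → Jet k ι) : evol d (P + Q) = evol d P + evol d Q := by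
  refine derivation_ext fun p => ?_
  rw [Derivation.add_apply, evol_X, evol_X, evol_X, Pi.add_apply, iterate_map_add]

theorem evol_eq_zero_iff (P : ι → Jet k ι) : evol d P = 0 ↔ P = 0 := by
  constructor
  · intro h
    ext1 i
    rw [← evol_X_zero d P i, h]
    rfl
  · rintro rfl
    refine derivation_ext fun p => ?_
    rw [evol_X, Pi.zero_apply, iterate_map_zero]
    rfl

theorem pderiv_totalDeriv_zero (i : ι) (F : Jet k ι) :
    pderiv (i, 0) (totalDeriv d F) = totalDeriv d (pderiv (i, 0) F) := by
  classical
  induction F using MvPolynomial.induction_on with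
  | C a => simp [totalDeriv_C]
  | add p q hp hq => simp [hp, hq]
  | mul_X p n hp =>
    have h1 : pderiv (i, 0) (X (n.1, n.2 + 1) : Jet k ι) = 0 :=
      pderiv_X_of_ne (by simp)
    have h2 : totalDeriv d (pderiv (i, 0) (X n) : Jet k ι) = 0 := by
      rw [pderiv_X, Pi.single_apply]; split_ifs <;> simp
    simp only [Derivation.leibniz, map_add, smul_eq_mul, totalDeriv_X, hp, h1, h2]
    ring

/-- The commutator of `∂/∂q^{(m+1)}` with `∂` is `∂/∂q^{(m)}`. All later arguments on the order and
leading coefficient of a differential polynomial rest on this. -/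
theorem pderiv_totalDeriv_succ (i : ι) (m : ℕ) (F : Jet k ι) :
    pderiv (i, m + 1) (totalDeriv d F)
      = totalDeriv d (pderiv (i, m + 1) F) + pderiv (i, m) F := by
  classical
  induction F using MvPolynomial.induction_on with
  | C a => simp [totalDeriv_C]
  | add p q hp hq => simp only [map_add, hp, hq]; ring
  | mul_X p n hp =>
    have h1 : pderiv (i, m + 1) (X (n.1, n.2 + 1) : Jet k ι) = pderiv (i, m) (X n) := by
      simp only [pderiv_X, Pi.single_apply]
      congr 1
      simp [Prod.ext_iff]
    have h2 : totalDeriv d (pderiv (i, m + 1) (X n) : Jet k ι) = 0 := by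
      rw [pderiv_X, Pi.single_apply]; split_ifs <;> simp
    simp only [Derivation.leibniz, map_add, smul_eq_mul, totalDeriv_X, hp, h1, h2]
    ring

/-- A polynomial involves finitely many variables; this turns the `finsum` in variational
derivatives into honest finite sums. -/
theorem exists_forall_pderiv_eq_zero {k ι : Type*} [CommRing k] (i : ι) (F : Jet k ι) :
    ∃ N, ∀ n, N ≤ n → pderiv (i, n) F = 0 := by
  refine ⟨F.vars.sup (fun p => p.2 + 1), fun n hn => pderiv_eq_zero_of_notMem_vars fun h => ?_⟩
  have : n + 1 ≤ F.vars.sup (fun p => p.2 + 1) :=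
    Finset.le_sup (f := fun p : ι × ℕ => p.2 + 1) h
  omega

/-- The adjoint of the Fréchet derivative of `G` in the direction of `q i`:
`f ↦ ∑_n (-∂)^n (∂G/∂q_i^{(n)} f)`. -/
noncomputable def adjFrechet (i : ι) (G f : Jet k ι) : Jet k ι :=
  ∑ᶠ n : ℕ, (-1) ^ n * (totalDeriv d)^[n] (pderiv (i, n) G * f)

theorem adjFrechet_eq_sum (i : ι) {G : Jet k ι} {N : ℕ} (h : ∀ n, N ≤ n → pderiv (i, n) G = 0)
    (f : Jet k ι) : adjFrechet d i G f =
      ∑ n ∈ Finset.range N, (-1) ^ n * (totalDeriv d)^[n] (pderiv (i, n) G * f) := by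
  refine finsum_eq_sum_of_support_subset _ fun n hn => ?_
  by_contra h'
  refine hn ?_
  simp only [Finset.coe_range, Set.mem_Iio, not_lt] at h'
  simp only [h n h', zero_mul, iterate_map_zero, mul_zero]

theorem varDeriv_eq (H : Jet k ι) (i : ι) : varDeriv d H i = adjFrechet d i H 1 := by
  simp [varDeriv, adjFrechet]

theorem adjFrechet_add_right (i : ι) (G f g : Jet k ι) :
    adjFrechet d i G (f + g) = adjFrechet d i G f + adjFrechet d i G g := by
  obtain ⟨N, hN⟩ := exists_forall_pderiv_eq_zero i G
  simp only [adjFrechet_eq_sum d i hN, mul_add, iterate_map_add, Finset.sum_add_distrib]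

theorem adjFrechet_add_left (i : ι) (G G' f : Jet k ι) :
    adjFrechet d i (G + G') f = adjFrechet d i G f + adjFrechet d i G' f := by
  obtain ⟨N, hN⟩ := exists_forall_pderiv_eq_zero i G
  obtain ⟨M, hM⟩ := exists_forall_pderiv_eq_zero i G'
  have hN' : ∀ n, max N M ≤ n → pderiv (i, n) G = 0 := fun n hn => hN n (by omega)
  have hM' : ∀ n, max N M ≤ n → pderiv (i, n) G' = 0 := fun n hn => hM n (by omega)
  have hNM : ∀ n, max N M ≤ n → pderiv (i, n) (G + G') = 0 := fun n hn => by
    rw [map_add, hN' n hn, hM' n hn, add_zero]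
  simp only [adjFrechet_eq_sum d i hN', adjFrechet_eq_sum d i hM', adjFrechet_eq_sum d i hNM,
    map_add, add_mul, mul_add, iterate_map_add, Finset.sum_add_distrib]

/-- `adjFrechet` as an additive map in both arguments. -/
noncomputable def adjFrechetHom (i : ι) : Jet k ι →+ Jet k ι →+ Jet k ι :=
  AddMonoidHom.mk' (fun G => AddMonoidHom.mk' (adjFrechet d i G) (adjFrechet_add_right d i G))
    fun G G' => AddMonoidHom.ext fun f => adjFrechet_add_left d i G G' f

theorem adjFrechetHom_apply (i : ι) (G f : Jet k ι) :
    adjFrechetHom d i G f = adjFrechet d i G f := rfl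

theorem adjFrechet_C (i : ι) (a : k) (f : Jet k ι) : adjFrechet d i (C a) f = 0 := by
  have h : ∀ n, 0 ≤ n → pderiv (i, n) (C a : Jet k ι) = 0 := fun n _ => pderiv_C
  simp [adjFrechet_eq_sum d i h]

theorem adjFrechet_mul (i : ι) (G G' f : Jet k ι) :
    adjFrechet d i (G * G') f = adjFrechet d i G (G' * f) + adjFrechet d i G' (G * f) := by
  obtain ⟨N, hN⟩ := exists_forall_pderiv_eq_zero i G
  obtain ⟨M, hM⟩ := exists_forall_pderiv_eq_zero i G'
  have hN' : ∀ n, max N M ≤ n → pderiv (i, n) G = 0 := fun n hn => hN n (by omega)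
  have hM' : ∀ n, max N M ≤ n → pderiv (i, n) G' = 0 := fun n hn => hM n (by omega)
  have hNM : ∀ n, max N M ≤ n → pderiv (i, n) (G * G') = 0 := fun n hn => by
    rw [pderiv_mul, hN' n hn, hM' n hn, zero_mul, mul_zero, add_zero]
  simp only [adjFrechet_eq_sum d i hN', adjFrechet_eq_sum d i hM', adjFrechet_eq_sum d i hNM,
    ← Finset.sum_add_distrib, ← mul_add, ← iterate_map_add, pderiv_mul]
  refine Finset.sum_congr rfl fun n _ => ?_
  congr 2
  ring

/-- The Fréchet derivative of `∂G` is `∂` composed with that of `G`, and the adjoint of `∂` is `-∂`.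
With `f = 1` this says that variational derivatives kill total derivatives. -/
theorem adjFrechet_totalDeriv (i : ι) (G f : Jet k ι) :
    adjFrechet d i (totalDeriv d G) f = adjFrechet d i G (-totalDeriv d f) := by
  obtain ⟨N, hN⟩ := exists_forall_pderiv_eq_zero i G
  have hN' : ∀ n, N + 1 ≤ n → pderiv (i, n) G = 0 := fun n hn => hN n (by omega)
  have hD : ∀ n, N + 1 ≤ n → pderiv (i, n) (totalDeriv d G) = 0 := by
    intro n hn
    obtain ⟨m, rfl⟩ : ∃ m, n = m + 1 := ⟨n - 1, by omega⟩
    rw [pderiv_totalDeriv_succ, hN m (by omega), hN _ (by omega), map_zero, add_zero]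
  rw [adjFrechet_eq_sum d i hD, adjFrechet_eq_sum d i hN', Finset.sum_range_succ',
    Finset.sum_range_succ' (n := N)]
  have key : ∀ n, (totalDeriv d)^[n + 1] (pderiv (i, n + 1) (totalDeriv d G) * f)
      = (totalDeriv d)^[n + 1] (pderiv (i, n + 1) G * -totalDeriv d f)
        + (totalDeriv d)^[n + 2] (pderiv (i, n + 1) G * f)
        + (totalDeriv d)^[n + 1] (pderiv (i, n) G * f) := by
    intro n
    rw [Function.iterate_succ_apply (totalDeriv d) (n + 1), ← iterate_map_add, ← iterate_map_add,
      pderiv_totalDeriv_succ, Derivation.leibniz]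
    congr 1
    simp only [smul_eq_mul]
    ring
  -- The shift `∂/∂q^{(n+1)} ↦ ∂/∂q^{(n)}` in the commutator produces consecutive terms with
  -- opposite signs; only the `n = 0` boundary term remains.
  have tel : ∑ n ∈ Finset.range N, ((-1 : Jet k ι) ^ (n + 1)
        * (totalDeriv d)^[n + 2] (pderiv (i, n + 1) G * f)
        - (-1) ^ n * (totalDeriv d)^[n + 1] (pderiv (i, n) G * f))
      = - totalDeriv d (pderiv (i, 0) G * f) := by
    rw [Finset.sum_range_sub (fun n => (-1 : Jet k ι) ^ n
        * (totalDeriv d)^[n + 1] (pderiv (i, n) G * f)), hN N le_rfl]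
    simp
  have h1 : ∑ n ∈ Finset.range N, (-1 : Jet k ι) ^ (n + 1)
        * (totalDeriv d)^[n + 1] (pderiv (i, n + 1) (totalDeriv d G) * f)
      = ∑ n ∈ Finset.range N, (-1 : Jet k ι) ^ (n + 1)
        * (totalDeriv d)^[n + 1] (pderiv (i, n + 1) G * -totalDeriv d f)
        + - totalDeriv d (pderiv (i, 0) G * f) := by
    rw [← tel, ← Finset.sum_add_distrib]
    refine Finset.sum_congr rfl fun n _ => ?_
    rw [key]
    ring
  rw [h1, pderiv_totalDeriv_zero]
  simp only [pow_zero, one_mul, Function.iterate_zero, id, Derivation.leibniz, smul_eq_mul]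
  ring

theorem adjFrechet_X [DecidableEq ι] (i j : ι) (m : ℕ) (f : Jet k ι) :
    adjFrechet d i (X (j, m)) f = if j = i then (-1) ^ m * (totalDeriv d)^[m] f else 0 := by
  rw [adjFrechet, finsum_eq_single _ m fun n hn => ?_]
  · split_ifs with h
    · subst h; simp
    · rw [pderiv_X_of_ne (by simp [h])]; simp
  · rw [pderiv_X_of_ne (by simp [hn.symm])]; simp

theorem adjFrechet_zero_right (i : ι) (G : Jet k ι) : adjFrechet d i G 0 = 0 :=
  (adjFrechetHom d i G).map_zero

theorem adjFrechet_neg_right (i : ι) (G f : Jet k ι) :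
    adjFrechet d i G (-f) = -adjFrechet d i G f :=
  (adjFrechetHom d i G).map_neg f

theorem adjFrechet_sum_left {s : Type*} (t : Finset s) (i : ι) (G : s → Jet k ι) (f : Jet k ι) :
    adjFrechet d i (∑ a ∈ t, G a) f = ∑ a ∈ t, adjFrechet d i (G a) f := by
  have := congrArg (fun T : Jet k ι →+ Jet k ι => T f) (map_sum (adjFrechetHom d i) G t)
  simpa only [AddMonoidHom.finsetSum_apply, adjFrechetHom_apply] using this

variable {d} in
theorem EqModDiv.refl (F : Jet k ι) : EqModDiv d F F := ⟨0, by simp⟩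

variable {d} in
theorem EqModDiv.of_eq {F G : Jet k ι} (h : F = G) : EqModDiv d F G := ⟨0, by simp [h]⟩

variable {d} in
theorem EqModDiv.symm {F G : Jet k ι} (h : EqModDiv d F G) : EqModDiv d G F := by
  obtain ⟨E, hE⟩ := h
  exact ⟨-E, by rw [map_neg, ← hE]; ring⟩

variable {d} in
theorem EqModDiv.trans {F G H : Jet k ι} (h : EqModDiv d F G) (h' : EqModDiv d G H) :
    EqModDiv d F H := by
  obtain ⟨E, hE⟩ := h
  obtain ⟨E', hE'⟩ := h'
  exact ⟨E + E', by rw [map_add, ← hE, ← hE']; ring⟩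

variable {d} in
theorem EqModDiv.add {F G F' G' : Jet k ι} (h : EqModDiv d F G) (h' : EqModDiv d F' G') :
    EqModDiv d (F + F') (G + G') := by
  obtain ⟨E, hE⟩ := h
  obtain ⟨E', hE'⟩ := h'
  exact ⟨E + E', by rw [map_add, ← hE, ← hE']; ring⟩

variable {d} in
theorem EqModDiv.neg {F G : Jet k ι} (h : EqModDiv d F G) : EqModDiv d (-F) (-G) := by
  obtain ⟨E, hE⟩ := h
  exact ⟨-E, by rw [map_neg, ← hE]; ring⟩

variable {d} in
theorem EqModDiv.evol {F G : Jet k ι} (h : EqModDiv d F G) (P : ι → Jet k ι) :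
    EqModDiv d (evol d P F) (evol d P G) := by
  obtain ⟨E, hE⟩ := h
  exact ⟨KdVExt.evol d P E, by rw [← map_sub, hE, evol_totalDeriv]⟩

variable {d} in
theorem EqModDiv.adjFrechet_one {F G : Jet k ι} (h : EqModDiv d F G) (i : ι) :
    adjFrechet d i F 1 = adjFrechet d i G 1 := by
  obtain ⟨E, hE⟩ := h
  rw [sub_eq_iff_eq_add.1 hE, adjFrechet_add_left, adjFrechet_totalDeriv]
  simp [adjFrechet_zero_right]

theorem mul_iterate_totalDeriv_eqModDiv (n : ℕ) (f g : Jet k ι) :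
    EqModDiv d (f * (totalDeriv d)^[n] g) (g * ((-1) ^ n * (totalDeriv d)^[n] f)) := by
  induction n generalizing g with
  | zero => exact .of_eq (by simp [mul_comm])
  | succ n ih =>
    rw [Function.iterate_succ_apply]
    refine (ih (totalDeriv d g)).trans ⟨g * ((-1) ^ n * (totalDeriv d)^[n] f), ?_⟩
    have h : totalDeriv d ((-1 : Jet k ι) ^ n) = 0 := by
      rcases neg_one_pow_eq_or (Jet k ι) n with h | h <;> simp [h]
    rw [Function.iterate_succ_apply']
    simp only [Derivation.leibniz, smul_eq_mul, h]
    ring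

section Fintype

variable [Fintype ι]

/-- Integration by parts: `evol d P F` is the Fréchet derivative of `F` applied to `P`, which is
moved onto `f` as its adjoint. Carrying a general `f` lets the induction on `F` absorb the other
factor of a product. -/
theorem mul_evol_eqModDiv (P : ι → Jet k ι) (F f : Jet k ι) :
    EqModDiv d (f * evol d P F) (∑ j, P j * adjFrechet d j F f) := by
  classical
  induction F using MvPolynomial.induction_on generalizing f with
  | C a => exact .of_eq (by simp [adjFrechet_C])
  | add p q hp hq =>
    simp only [map_add, mul_add, adjFrechet_add_left, Finset.sum_add_distrib]
    exact (hp f).add (hq f)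
  | mul_X p n hp =>
    have hX : EqModDiv d (p * f * evol d P (X n)) (∑ j, P j * adjFrechet d j (X n) (p * f)) := by
      obtain ⟨i, n⟩ := n
      simp only [evol_X, adjFrechet_X, mul_ite, mul_zero, Finset.sum_ite_eq, Finset.mem_univ,
        if_true]
      exact mul_iterate_totalDeriv_eqModDiv d n _ _
    simp only [adjFrechet_mul, mul_add, Finset.sum_add_distrib]
    refine EqModDiv.trans (.of_eq ?_) ((hp (X n * f)).add hX)
    simp only [Derivation.leibniz, smul_eq_mul]
    ring

theorem evol_eqModDiv (P : ι → Jet k ι) (F : Jet k ι) :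
    EqModDiv d (evol d P F) (∑ j, P j * varDeriv d F j) := by
  simpa [varDeriv_eq] using mul_evol_eqModDiv d P F 1

/-- Adjoint form of the chain rule: the Fréchet derivative of `X_P F` is that of `F` with its
coefficients differentiated along `X_P`, plus the composition of those of `F` and `P`. Taking
adjoints reverses the composition. -/
theorem adjFrechet_evol (P : ι → Jet k ι) (i : ι) (F f : Jet k ι) :
    adjFrechet d i (evol d P F) f = evol d P (adjFrechet d i F f) - adjFrechet d i F (evol d P f)
      + ∑ j, adjFrechet d i (P j) (adjFrechet d j F f) := by
  classical
  induction F using MvPolynomial.induction_on generalizing f with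
  | C a =>
    have h0 : adjFrechet d i (0 : Jet k ι) f = 0 := by
      simpa using adjFrechet_C d i 0 f
    simp [adjFrechet_C, adjFrechet_zero_right, h0]
  | add p q hp hq =>
    simp only [map_add, adjFrechet_add_left, adjFrechet_add_right, hp, hq, Finset.sum_add_distrib]
    ring
  | mul_X p n hp =>
    have hX : ∀ f, adjFrechet d i (evol d P (X n)) f = evol d P (adjFrechet d i (X n) f)
        - adjFrechet d i (X n) (evol d P f)
        + ∑ j, adjFrechet d i (P j) (adjFrechet d j (X n) f) := by
      intro f
      obtain ⟨j, n⟩ := n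
      have hit : ∀ (n : ℕ) (f : Jet k ι), adjFrechet d i ((totalDeriv d)^[n] (P j)) f
          = adjFrechet d i (P j) ((-1) ^ n * (totalDeriv d)^[n] f) := by
        intro n
        induction n with
        | zero => simp
        | succ n ih =>
          intro f
          rw [Function.iterate_succ_apply', adjFrechet_totalDeriv, ih, Function.iterate_succ_apply,
            iterate_map_neg]
          congr 1
          ring
      have hpow : evol d P ((-1 : Jet k ι) ^ n) = 0 := by
        rcases neg_one_pow_eq_or (Jet k ι) n with h | h <;> simp [h]
      have hs : ∑ l, adjFrechet d i (P l) (adjFrechet d l (X (j, n)) f)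
          = adjFrechet d i (P j) ((-1) ^ n * (totalDeriv d)^[n] f) := by
        rw [Finset.sum_eq_single j]
        · rw [adjFrechet_X, if_pos rfl]
        · intro l _ hl
          rw [adjFrechet_X, if_neg hl.symm, adjFrechet_zero_right]
        · simp
      rw [evol_X, hit, hs, adjFrechet_X, adjFrechet_X]
      split_ifs
      · rw [Derivation.leibniz, hpow, evol_iterate_totalDeriv]
        simp
      · simp
    simp only [Derivation.leibniz, smul_eq_mul, adjFrechet_add_left, adjFrechet_mul,
      adjFrechet_add_right, map_add, Finset.sum_add_distrib, hp (X n * f), hX (p * f)]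
    ring_nf

/-- The Fréchet derivative of a variational derivative is self-adjoint. -/
theorem evol_varDeriv (P : ι → Jet k ι) (F : Jet k ι) (i : ι) :
    evol d P (varDeriv d F i) = ∑ j, adjFrechet d i (varDeriv d F j) (P j) := by
  -- Compute `δ(X_P F)` in two ways: by the chain rule, and by the product rule after replacing `X_P
  -- F` with `∑ P_j δF/δq_j`. The terms `L_{P_j}(δF/δq_j)` cancel.
  have h1 := adjFrechet_evol d P i F 1
  have h2 := (evol_eqModDiv d P F).adjFrechet_one i
  rw [h2, adjFrechet_sum_left] at h1
  simp only [adjFrechet_mul, mul_one, Finset.sum_add_distrib, Derivation.map_one_eq_zero,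
    adjFrechet_zero_right, sub_zero] at h1
  simp only [← varDeriv_eq] at h1
  rw [add_comm] at h1
  exact (add_right_cancel h1).symm

theorem varDeriv_evol (P : ι → Jet k ι) (F : Jet k ι) (i : ι) :
    varDeriv d (evol d P F) i = evol d P (varDeriv d F i)
      + ∑ j, adjFrechet d i (P j) (varDeriv d F j) := by
  simp [varDeriv_eq, adjFrechet_evol, adjFrechet_zero_right]

/-- A skew matrix for which `H ↦ X_H` maps Poisson brackets to commutators is Hamiltonian. -/
theorem isHamiltonian_of_commutator {B : Matrix ι ι (Module.End K (Jet k ι))}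
    (skew : ∀ P Q : ι → Jet k ι,
      EqModDiv d (∑ i, P i * matApply B Q i) (-∑ i, Q i * matApply B P i))
    (comm : ∀ H F : Jet k ι, ⁅hamField d B H, hamField d B F⁆ = hamField d B (bracket d B H F)) :
    IsHamiltonian d B := by
  refine ⟨skew, fun H F G => ?_, comm⟩
  have hb : ∀ H F, EqModDiv d (bracket d B H F) (-bracket d B F H) := by
    intro H F
    have e : ∀ H F, EqModDiv d (bracket d B H F)
        (∑ i, varDeriv d F i * matApply B (varDeriv d H) i) := fun H F =>
      (evol_eqModDiv d _ F).trans (.of_eq (Finset.sum_congr rfl fun i _ => mul_comm _ _))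
    exact (e H F).trans ((skew _ _).trans (e F H).neg.symm)
  -- Skewness turns the cyclic sum into `X_H X_F G - X_F X_H G - X_{{H,F}} G`, which vanishes by the
  -- commutator hypothesis.
  have h1 : EqModDiv d (bracket d B F (bracket d B G H)) (-bracket d B F (bracket d B H G)) := by
    rw [bracket, hamField]
    refine ((hb G H).evol _).trans (.of_eq ?_)
    rw [map_neg]; rfl
  have h2 := hb G (bracket d B H F)
  refine ((((EqModDiv.refl (bracket d B H (bracket d B F G))).add h1).add h2).trans (.of_eq ?_))
  have h3 := DFunLike.congr_fun (comm H F) G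
  rw [Derivation.commutator_apply] at h3
  have h4 : bracket d B (bracket d B H F) G = hamField d B (bracket d B H F) G := rfl
  rw [h4, ← h3]
  simp only [bracket]
  ring

end Fintype

end Calculus

/-! ### The Hamiltonian matrix and its semidirect-sum and cocycle parts -/

section Extension

variable {K k : Type*} [Field K] [CommRing k] [Algebra K k] (d : Derivation K k k)

theorem smul_jet {K ι : Type*} [CommRing K] [Algebra K k] (c : K) (x : Jet k ι) :
    c • x = algebraMap K (Jet k ι) c * x :=
  Algebra.smul_def c x

theorem matApply_add {K ι : Type*} [CommRing K] [Algebra K k] [Fintype ι]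
    (B : Matrix ι ι (Module.End K (Jet k ι))) (P Q : ι → Jet k ι) :
    matApply B (P + Q) = matApply B P + matApply B Q := by
  ext1 i
  simp [matApply, Finset.sum_add_distrib]

theorem correspondsToSemiDir_linMatrix (lam : K) :
    CorrespondsToSemiDir d lam (linMatrix d lam) := by
  intro x y
  obtain ⟨f, v⟩ := x
  obtain ⟨g, w⟩ := y
  refine ⟨X (0, 0) * C v.val * C w.val
    - algebraMap K _ lam * (X (1, 0) * C v.val * C g.val) + X (1, 0) * C f.val * C w.val , ?_⟩
  have hc (c : K) (a : k) : (C (c • a) : Jet k (Fin 2)) = algebraMap K _ c * C a := by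
    rw [Algebra.smul_def, C_mul]; rfl
  have e1 : coords (⁅(⟨f, v⟩ : SemiDir d lam), ⟨g, w⟩⁆) 0
      = C (v.val * d w.val - d v.val * w.val) := rfl
  have e2 : coords (⁅(⟨f, v⟩ : SemiDir d lam), ⟨g, w⟩⁆) 1
      = C (0 + (v.val * d g.val + lam • (d v.val * g.val))
          - (w.val * d f.val + lam • (d w.val * f.val))) := rfl
  simp only [Fin.sum_univ_two, e1, e2]
  simp only [coords, matApply, linMatrix, dOp, mulOp, Fin.sum_univ_two,
    Matrix.cons_val_zero, Matrix.cons_val_one, Matrix.of_apply,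
    LinearMap.smul_apply, LinearMap.add_apply, LinearMap.sub_apply, LinearMap.zero_apply,
    Module.End.mul_apply,
    LinearMap.mulLeft_apply, Derivation.coeFn_coe, smul_jet, hc,
    Derivation.leibniz, smul_eq_mul, totalDeriv_X, totalDeriv_C, map_add, map_sub, C_mul,
    totalDeriv_algebraMap, zero_add]
  ring

theorem gfForm_apply (x y : VectField d) :
    gfForm d x y = (1 / 2 : K) • (x.val * d (d (d y.val))) := rfl

theorem coords_constMatrix (lam : K) (x y : SemiDir d lam) :
    ∑ i, coords x i * matApply (constMatrix d) (coords y) i =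
      C (gfForm d x.right y.right) := by
  have hc (c : K) (a : k) : (C (c • a) : Jet k (Fin 2)) = algebraMap K _ c * C a := by
    rw [Algebra.smul_def, C_mul]; rfl
  simp only [coords, matApply, constMatrix, dOp, Fin.sum_univ_two, pow_succ, pow_zero, one_mul,
    Matrix.cons_val_zero, Matrix.cons_val_one, Matrix.of_apply, gfForm_apply, hc,
    LinearMap.smul_apply, LinearMap.zero_apply, Module.End.mul_apply,
    Derivation.coeFn_coe, smul_jet, totalDeriv_C, C_mul]
  ring

theorem isGenCocycle_gfForm : IsGenCocycle d (gfForm d) := by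
  have hf : ∀ x y, gfForm d x y = algebraMap K k (1 / 2) * (x.val * d (d (d y.val))) := by
    intro x y
    rw [← Algebra.smul_def, gfForm_apply]
  constructor
  · intro x y
    refine ⟨algebraMap K k (1 / 2) * (x.val * d (d y.val) + d (d x.val) * y.val
      - d x.val * d y.val), ?_⟩
    simp only [hf, Derivation.leibniz, map_add, map_sub, smul_eq_mul, Derivation.map_algebraMap]
    ring
  · intro x y z
    -- The primitive is half the cyclic sum of `[X,Y]Z''`: differentiating `Z''` gives the required
    -- terms, and the cyclic sum of `(XY'' - X''Y)Z''` is zero.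
    refine ⟨algebraMap K k (1 / 2) * ((x.val * d y.val - d x.val * y.val) * d (d z.val)
      + (y.val * d z.val - d y.val * z.val) * d (d x.val)
      + (z.val * d x.val - d z.val * x.val) * d (d y.val)), ?_⟩
    simp only [hf, VectField.val_lie, Derivation.leibniz, map_add, map_sub, smul_eq_mul,
      Derivation.map_algebraMap]
    ring

variable [CharZero K]

theorem matApply_extMatrix_zero (α : K) (P : Fin 2 → Jet k (Fin 2)) :
    matApply (extMatrix d α) P 0 =
      4 * X (0, 0) * totalDeriv d (P 0) + 2 * X (0, 1) * P 0
        + totalDeriv d (totalDeriv d (totalDeriv d (P 0)))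
        - 2 * X (1, 1) * P 1 + algebraMap K _ α * totalDeriv d (X (1, 0) * P 1) := by
  have e1 : algebraMap K (Jet k (Fin 2)) 2 = 2 := map_ofNat _ 2
  have e2 : algebraMap K (Jet k (Fin 2)) 2 * algebraMap K (Jet k (Fin 2)) (1 / 2) = 1 := by
    rw [← map_mul]; norm_num
  have e3 : algebraMap K (Jet k (Fin 2)) 2 * algebraMap K (Jet k (Fin 2)) (α / 2)
      = algebraMap K (Jet k (Fin 2)) α := by
    rw [← map_mul]; congr 1; field_simp
  simp only [matApply, extMatrix, dOp, mulOp, pow_succ, pow_zero, one_mul, Fin.sum_univ_two,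
    Matrix.smul_apply, Matrix.cons_val_zero, Matrix.cons_val_one, Matrix.of_apply,
    LinearMap.smul_apply, LinearMap.add_apply, LinearMap.neg_apply, Module.End.mul_apply,
    LinearMap.mulLeft_apply, Derivation.coeFn_coe, smul_jet,
    Derivation.leibniz, smul_eq_mul, totalDeriv_X]
  rw [e1] at e2 e3 ⊢
  linear_combination totalDeriv d (totalDeriv d (totalDeriv d (P 0))) * e2
    + (X (1, 0) * totalDeriv d (P 1) + P 1 * X (1, 1)) * e3

theorem matApply_extMatrix_one (α : K) (P : Fin 2 → Jet k (Fin 2)) :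
    matApply (extMatrix d α) P 1 =
      2 * X (1, 1) * P 0 + algebraMap K _ α * (X (1, 0) * totalDeriv d (P 0)) := by
  have e1 : algebraMap K (Jet k (Fin 2)) 2 = 2 := map_ofNat _ 2
  have e3 : algebraMap K (Jet k (Fin 2)) 2 * algebraMap K (Jet k (Fin 2)) (α / 2)
      = algebraMap K (Jet k (Fin 2)) α := by
    rw [← map_mul]; congr 1; field_simp
  simp only [matApply, extMatrix, dOp, mulOp, Fin.sum_univ_two,
    Matrix.smul_apply, Matrix.cons_val_zero, Matrix.cons_val_one, Matrix.of_apply,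
    LinearMap.smul_apply, LinearMap.add_apply, LinearMap.zero_apply, Module.End.mul_apply,
    LinearMap.mulLeft_apply, Derivation.coeFn_coe, smul_jet]
  rw [e1] at e3 ⊢
  linear_combination (X (1, 0) * totalDeriv d (P 0)) * e3

theorem extMatrix_eq (α : K) :
    extMatrix d α = (2 : K) • (linMatrix d (1 - α / 2) + constMatrix d) := by
  refine Matrix.ext fun i j => LinearMap.ext fun P => ?_
  fin_cases i <;> fin_cases j <;>
    simp [extMatrix, linMatrix, constMatrix, dOp, mulOp, sub_smul] <;> ring_nf
  module

theorem extMatrix_skew (α : K) (P Q : Fin 2 → Jet k (Fin 2)) :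
    EqModDiv d (∑ i, P i * matApply (extMatrix d α) Q i)
      (-∑ i, Q i * matApply (extMatrix d α) P i) := by
  refine ⟨4 * X (0, 0) * P 0 * Q 0 + P 0 * totalDeriv d (totalDeriv d (Q 0))
    + totalDeriv d (totalDeriv d (P 0)) * Q 0 - totalDeriv d (P 0) * totalDeriv d (Q 0)
    + algebraMap K _ α * X (1, 0) * (Q 1 * P 0 + P 1 * Q 0), ?_⟩
  have h4 : totalDeriv d (4 : Jet k (Fin 2)) = 0 := (totalDeriv d).map_natCast 4
  simp only [Fin.sum_univ_two, matApply_extMatrix_zero, matApply_extMatrix_one,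
    Derivation.leibniz, map_add, map_sub, smul_eq_mul, totalDeriv_algebraMap, h4, totalDeriv_X]
  ring

/-- The part of `δ{H, F}` which comes from the explicit dependence of the matrix on the fields. -/
noncomputable def extTorsion (α : K) (P Q : Fin 2 → Jet k (Fin 2)) : Fin 2 → Jet k (Fin 2) :=
  ![2 * (totalDeriv d (P 0) * Q 0 - P 0 * totalDeriv d (Q 0)),
    2 * totalDeriv d (P 1) * Q 0 - 2 * P 0 * totalDeriv d (Q 1) - 2 * totalDeriv d (P 0) * Q 1
      + 2 * P 1 * totalDeriv d (Q 0)
      - algebraMap K _ α * P 1 * totalDeriv d (Q 0) + algebraMap K _ α * totalDeriv d (P 0) * Q 1]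

/-- Differentiating `BP` through `P` yields the adjoint of `B`, that is `-B`, applied to `Q`;
differentiating the fields occurring in `B` yields the torsion term. -/
theorem sum_adjFrechet_extMatrix (α : K) (P Q : Fin 2 → Jet k (Fin 2)) (i : Fin 2) :
    ∑ j, adjFrechet d i (matApply (extMatrix d α) P j) (Q j) =
      extTorsion d α P Q i
        - ∑ j, adjFrechet d i (P j) (matApply (extMatrix d α) Q j) := by
  have h2 : ∀ f, adjFrechet d i (2 : Jet k (Fin 2)) f = 0 := fun f => by
    rw [← map_ofNat C]; exact adjFrechet_C d i _ f
  have h4 : ∀ f, adjFrechet d i (4 : Jet k (Fin 2)) f = 0 := fun f => by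
    rw [← map_ofNat C]; exact adjFrechet_C d i _ f
  have ha : ∀ f, adjFrechet d i (algebraMap K (Jet k (Fin 2)) α) f = 0 :=
    fun f => adjFrechet_C d i (algebraMap K k α) f
  have d2 : totalDeriv d (2 : Jet k (Fin 2)) = 0 := (totalDeriv d).map_natCast 2
  have d4 : totalDeriv d (4 : Jet k (Fin 2)) = 0 := (totalDeriv d).map_natCast 4
  have hsub : ∀ G G' f : Jet k (Fin 2), adjFrechet d i (G - G') f
      = adjFrechet d i G f + adjFrechet d i G' (-f) := fun G G' f => by
    rw [adjFrechet_neg_right, ← sub_eq_add_neg]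
    exact congrArg (fun T => T f) ((adjFrechetHom d i).map_sub G G')
  simp only [Fin.sum_univ_two, matApply_extMatrix_zero, matApply_extMatrix_one,
    adjFrechet_add_left, hsub, adjFrechet_mul, adjFrechet_totalDeriv, h2, h4, ha, zero_add,
    adjFrechet_X]
  generalize hL : adjFrechetHom d i (P 0) = L0
  generalize hL' : adjFrechetHom d i (P 1) = L1
  have e0 : ∀ f, adjFrechet d i (P 0) f = L0 f := fun f => by rw [← hL]; rfl
  have e1 : ∀ f, adjFrechet d i (P 1) f = L1 f := fun f => by rw [← hL']; rfl
  simp only [e0, e1]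
  have hC : totalDeriv d (C (algebraMap K k α) : Jet k (Fin 2)) = 0 := totalDeriv_algebraMap d α
  -- `L0` is used only as an additive map, so the numeral inside its argument has to be split as `4
  -- = 2 + 2`.
  have h42 : L0 (Q 0 * X (0, 1) * 4) = L0 (Q 0 * X (0, 1) * 2) + L0 (Q 0 * X (0, 1) * 2) := by
    rw [← map_add]; congr 1; ring
  fin_cases i <;>
  · simp [extTorsion, d2, d4, hC, mul_add, mul_sub]
    ring_nf
    rw [h42]
    ring

/-- This is the Hamiltonian condition stripped of functionals: `B T(P,Q)` equals the derivative of
the coefficients of `B` along `BP`, applied to `Q`, minus the same with `P` and `Q` exchanged. It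
needs no assumption that `P` and `Q` are variational derivatives. -/
theorem extMatrix_torsion (α : K) (P Q : Fin 2 → Jet k (Fin 2)) (i : Fin 2) :
    matApply (extMatrix d α) (extTorsion d α P Q) i =
      (evol d (matApply (extMatrix d α) P) (matApply (extMatrix d α) Q i)
        - matApply (extMatrix d α) (fun j => evol d (matApply (extMatrix d α) P) (Q j)) i)
      - (evol d (matApply (extMatrix d α) Q) (matApply (extMatrix d α) P i)
        - matApply (extMatrix d α) (fun j => evol d (matApply (extMatrix d α) Q) (P j)) i) := by
  have d2 : totalDeriv d (2 : Jet k (Fin 2)) = 0 := (totalDeriv d).map_natCast 2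
  have d4 : totalDeriv d (4 : Jet k (Fin 2)) = 0 := (totalDeriv d).map_natCast 4
  have e2 : ∀ P, evol d P (2 : Jet k (Fin 2)) = 0 := fun P => (evol d P).map_natCast 2
  have e4 : ∀ P, evol d P (4 : Jet k (Fin 2)) = 0 := fun P => (evol d P).map_natCast 4
  fin_cases i
  · simp only [Fin.zero_eta, matApply_extMatrix_zero, matApply_extMatrix_one, extTorsion,
      Derivation.leibniz, map_add, map_sub, smul_eq_mul, evol_totalDeriv, evol_algebraMap,
      evol_X_zero, evol_X_one, totalDeriv_X, d2, d4, e2, e4, totalDeriv_algebraMap,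
      Matrix.cons_val_zero, Matrix.cons_val_one, zero_add, map_zero]
    ring
  · simp only [Fin.mk_one, matApply_extMatrix_one, extTorsion,
      Derivation.leibniz, map_add, map_sub, smul_eq_mul, evol_totalDeriv, evol_algebraMap,
      evol_X_zero, evol_X_one, totalDeriv_X, d2, e2, totalDeriv_algebraMap,
      Matrix.cons_val_zero, zero_add]
    ring

theorem isHamiltonian_extMatrix (α : K) : IsHamiltonian d (extMatrix d α) := by
  refine isHamiltonian_of_commutator d (extMatrix_skew d α) fun H F => ?_
  rw [hamField, hamField, hamField, lie_evol]
  congr 1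
  -- Here the arguments must be variational derivatives: self-adjointness rewrites `∑
  -- L_{P_j}((BQ)_j)` as the derivative of `P = δH` along `X_F`.
  have hB : varDeriv d (bracket d (extMatrix d α) H F) =
      extTorsion d α (varDeriv d H) (varDeriv d F)
      + (fun j => evol d (matApply (extMatrix d α) (varDeriv d H)) (varDeriv d F j))
      + -(fun j => evol d (matApply (extMatrix d α) (varDeriv d F)) (varDeriv d H j)) := by
    ext1 i
    rw [bracket, hamField, varDeriv_evol, sum_adjFrechet_extMatrix]
    simp only [Pi.add_apply, Pi.neg_apply, evol_varDeriv d _ H]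
    ring
  have hneg : ∀ P, matApply (extMatrix d α) (-P) = -matApply (extMatrix d α) P := fun P => by
    ext1 i
    simp [matApply, add_comm]
  ext1 i
  rw [hB, matApply_add, matApply_add, hneg]
  simp only [Pi.add_apply, Pi.neg_apply, extMatrix_torsion]
  ring

end Extension

/-! ### Order of a differential polynomial and the kernel of the total derivative -/

section ConstantCoefficients

variable {K ι : Type*} [Field K] [CharZero K]

omit [CharZero K] in
theorem exists_order {i : ι} {f : Jet K ι} (h : ∃ n, pderiv (i, n) f ≠ 0) :
    ∃ m, pderiv (i, m) f ≠ 0 ∧ ∀ n, m < n → pderiv (i, n) f = 0 := by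
  classical
  have hb := exists_forall_pderiv_eq_zero i f
  obtain ⟨n, hn⟩ := h
  have h0 : Nat.find hb ≠ 0 := fun h0 => hn (Nat.find_spec hb n (by omega))
  have h1 := Nat.find_min hb (m := Nat.find hb - 1) (by omega)
  push Not at h1
  obtain ⟨m, hm, hm'⟩ := h1
  have : ∀ n, Nat.find hb ≤ n → pderiv (i, n) f = 0 := Nat.find_spec hb
  refine ⟨m, hm', fun n hn => this n (by omega)⟩

theorem coeff_eq_zero_of_pderiv_eq_zero {σ : Type*} {f : MvPolynomial σ K} {p : σ}
    (h : pderiv p f = 0) {m : σ →₀ ℕ} (hp : m p ≠ 0) : coeff m f = 0 := by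
  classical
  have h1 := coeff_pderiv (i := p) f (m - Finsupp.single p 1)
  have h2 : m - Finsupp.single p 1 + Finsupp.single p 1 = m := by
    refine tsub_add_cancel_of_le ?_
    rw [Finsupp.single_le_iff]
    omega
  rw [h, h2, coeff_zero] at h1
  exact (mul_eq_zero.1 h1.symm).resolve_right (Nat.cast_add_one_ne_zero _)

theorem eq_C_of_pderiv_eq_zero {σ : Type*} {f : MvPolynomial σ K} (h : ∀ p, pderiv p f = 0) :
    f = C (constantCoeff f) := by
  classical
  ext m
  rw [coeff_C]
  split_ifs with hm
  · subst hm; rfl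
  · obtain ⟨p, hp⟩ : ∃ p, m p ≠ 0 := by
      by_contra! h0
      exact hm (Finsupp.ext fun p => (h0 p).symm)
    exact coeff_eq_zero_of_pderiv_eq_zero (h p) hp

/-- If `f` had order `m` in some field, the derivative of `∂f` by the variable of order `m + 1`
would be the nonzero top derivative of `f`. -/
theorem eq_C_of_D_eq_zero {f : Jet K ι} (h : D ι f = 0) : f = C (constantCoeff f) := by
  refine eq_C_of_pderiv_eq_zero fun ⟨i, n⟩ => ?_
  by_contra hn
  obtain ⟨m, hm, hm'⟩ := exists_order ⟨n, hn⟩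
  have h1 := pderiv_totalDeriv_succ (0 : Derivation K K K) i m f
  rw [hm' (m + 1) (by omega)] at h1
  change totalDeriv 0 f = 0 at h
  rw [h, map_zero, map_zero, zero_add] at h1
  exact hm h1.symm

omit [CharZero K] in
theorem D_C (a : K) : D ι (C a) = 0 := by
  rw [totalDeriv_C]; simp

omit [CharZero K] in
theorem constantCoeff_D (f : Jet K ι) : constantCoeff (D ι f) = 0 := by
  induction f using MvPolynomial.induction_on with
  | C a => rw [D_C, map_zero]
  | add p q hp hq => rw [map_add, map_add, hp, hq, add_zero]
  | mul_X p n hp => simp [hp]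

end ConstantCoefficients

/-! ### Existence and uniqueness of the KdV sequence -/

section KdVSequence

variable {K : Type*} [Field K]

/-- The operator `∂³ + 2u∂ + 2∂u`. -/
noncomputable def kdvOp (f : Jet K (Fin 1)) : Jet K (Fin 1) :=
  D (Fin 1) (D (Fin 1) (D (Fin 1) f)) + 2 * X (0, 0) * D (Fin 1) f + 2 * D (Fin 1) (X (0, 0) * f)

/-- A primitive of `a P(b) + b P(a)`, where `P = ∂³ + 2u∂ + 2∂u`. -/
noncomputable def kdvQuad (a b : Jet K (Fin 1)) : Jet K (Fin 1) :=
  a * D (Fin 1) (D (Fin 1) b) + D (Fin 1) (D (Fin 1) a) * b - D (Fin 1) a * D (Fin 1) b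
    + 4 * X (0, 0) * a * b

theorem D_ofNat (n : ℕ) [n.AtLeastTwo] : D (Fin 1) (ofNat(n) : Jet K (Fin 1)) = 0 :=
  (D (Fin 1)).map_natCast n

theorem D_kdvQuad (a b : Jet K (Fin 1)) :
    D (Fin 1) (kdvQuad a b) = a * kdvOp b + b * kdvOp a := by
  simp only [kdvQuad, kdvOp, Derivation.leibniz, map_add, map_sub, smul_eq_mul, totalDeriv_X,
    D_ofNat 4]
  ring

/-- The differential polynomials `h_n` of the KdV hierarchy. -/
noncomputable def kdvSeq : ℕ → Jet K (Fin 1)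
  | 0 => C (1 / 2)
  | n + 1 => ∑ i : Fin (n + 1), kdvQuad (kdvSeq i) (kdvSeq (n - i))
      - ∑ i : Fin n, kdvSeq (i + 1) * kdvSeq (n - i)

theorem kdvSeq_zero : kdvSeq 0 = (C (1 / 2) : Jet K (Fin 1)) := by rw [kdvSeq]

/-- This is the coefficient of `z^{n+1}` in the integrated relation `z Q(h,h) - h² = -1/4`, with `Q`
for `kdvQuad`. Since `h_0 = 1/2`, the two extreme terms of `h²` add up to exactly `h_{n+1}`. -/
theorem kdvSeq_succ (n : ℕ) : (kdvSeq (n + 1) : Jet K (Fin 1)) =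
    ∑ i ∈ Finset.range (n + 1), kdvQuad (kdvSeq i) (kdvSeq (n - i))
      - ∑ i ∈ Finset.range n, kdvSeq (i + 1) * kdvSeq (n - i) := by
  rw [kdvSeq, Finset.sum_range, Finset.sum_range]

theorem constantCoeff_kdvSeq_succ (n : ℕ) :
    constantCoeff (kdvSeq (n + 1) : Jet K (Fin 1)) = 0 := by
  induction n using Nat.strong_induction_on with
  | _ n ih =>
    rw [kdvSeq_succ, map_sub, map_sum, map_sum, Finset.sum_eq_zero, Finset.sum_eq_zero, sub_zero]
    · intro i hi
      rw [map_mul, ih i (Finset.mem_range.1 hi), zero_mul]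
    · intro i _
      simp [kdvQuad, constantCoeff_D]

theorem kdvOp_kdvSeq [CharZero K] (n : ℕ) :
    kdvOp (kdvSeq n : Jet K (Fin 1)) = D (Fin 1) (kdvSeq (n + 1)) := by
  induction n using Nat.strong_induction_on with
  | _ n ih =>
    have e1 : ∑ i ∈ Finset.range (n + 1), kdvSeq (n - i) * kdvOp (kdvSeq i : Jet K (Fin 1))
        = ∑ i ∈ Finset.range (n + 1), kdvSeq i * kdvOp (kdvSeq (n - i)) := by
      rw [← Finset.sum_range_reflect]
      refine Finset.sum_congr rfl fun i hi => ?_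
      rw [Finset.mem_range] at hi
      rw [show n + 1 - 1 - i = n - i by omega, show n - (n - i) = i by omega]
    have e2 : ∑ i ∈ Finset.range n, kdvSeq (i + 1) * D (Fin 1) (kdvSeq (n - i) : Jet K (Fin 1))
        = ∑ i ∈ Finset.range n, kdvSeq (n - i) * D (Fin 1) (kdvSeq (i + 1)) := by
      rw [← Finset.sum_range_reflect]
      refine Finset.sum_congr rfl fun i hi => ?_
      rw [Finset.mem_range] at hi
      rw [show n - 1 - i + 1 = n - i by omega, show n - (n - 1 - i) = i + 1 by omega]
    have e3 : ∑ i ∈ Finset.range n, kdvSeq (i + 1) * kdvOp (kdvSeq (n - (i + 1)) : Jet K (Fin 1))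
        = ∑ i ∈ Finset.range n, kdvSeq (n - i) * D (Fin 1) (kdvSeq (i + 1)) := by
      rw [← e2]
      refine Finset.sum_congr rfl fun i hi => ?_
      rw [Finset.mem_range] at hi
      rw [ih _ (by omega), show n - (i + 1) + 1 = n - i by omega]
    have h2 : (C (1 / 2) : Jet K (Fin 1)) * 2 = 1 := by
      rw [← map_ofNat (C (σ := Fin 1 × ℕ) (R := K)) 2, ← C_mul]
      norm_num
    rw [kdvSeq_succ, map_sub, map_sum, map_sum]
    simp only [D_kdvQuad, Derivation.leibniz, smul_eq_mul, Finset.sum_add_distrib]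
    -- By the induction hypothesis every term with positive index cancels against the derivative of
    -- the subtracted products. What is left is `2 h_0 P(h_n) = P(h_n)`.
    rw [e1, e2, Finset.sum_range_succ', e3, kdvSeq_zero, Nat.sub_zero]
    linear_combination -kdvOp (kdvSeq n) * h2

theorem isKdVSequence_kdvSeq [CharZero K] : IsKdVSequence (kdvSeq (K := K)) where
  init := kdvSeq_zero
  recursion := kdvOp_kdvSeq
  normalized := constantCoeff_kdvSeq_succ

theorem IsKdVSequence.eq_kdvSeq [CharZero K] {h : ℕ → Jet K (Fin 1)} (hh : IsKdVSequence h) :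
    h = kdvSeq := by
  ext1 n
  induction n with
  | zero => rw [hh.init, kdvSeq_zero]
  | succ n ih =>
    have h1 : D (Fin 1) (h (n + 1) - kdvSeq (n + 1)) = 0 := by
      rw [map_sub, ← kdvOp_kdvSeq, ← ih, sub_eq_zero]
      exact (hh.recursion n).symm
    have h2 := eq_C_of_D_eq_zero h1
    rwa [map_sub, hh.normalized, constantCoeff_kdvSeq_succ, sub_zero, C_0, sub_eq_zero] at h2

theorem D_kdvSeq_zero : D (Fin 1) (kdvSeq 0 : Jet K (Fin 1)) = 0 := by
  rw [kdvSeq_zero, D_C]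

theorem kdvSeq_one [CharZero K] : (kdvSeq 1 : Jet K (Fin 1)) = X (0, 0) := by
  have h4 : (4 : Jet K (Fin 1)) = C 4 := (map_ofNat C 4).symm
  rw [kdvSeq_succ]
  simp only [zero_add, Finset.range_one, Finset.sum_singleton, Finset.range_zero, Finset.sum_empty,
    sub_zero, kdvQuad, Nat.sub_zero, kdvSeq_zero, h4, D_C, map_zero]
  have : (C 4 * C (1 / 2) * C (1 / 2) : Jet K (Fin 1)) = 1 := by
    rw [← C_mul, ← C_mul]; norm_num
  linear_combination X (0, 0) * this

end KdVSequence

/-! ### Total and adjoint Fréchet derivatives on power series -/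

section PowerSeries

variable {K : Type*} [Field K]

/-- An additive map applied to all coefficients of a power series. -/
noncomputable def coeffMap {A : Type*} [CommRing A] (T : A →+ A) :
    PowerSeries A →+ PowerSeries A :=
  AddMonoidHom.mk' (fun f => PowerSeries.mk fun n => T (PowerSeries.coeff n f)) fun f g => by
    ext n; simp

theorem coeff_coeffMap {A : Type*} [CommRing A] (T : A →+ A) (n : ℕ) (f : PowerSeries A) :
    PowerSeries.coeff n (coeffMap T f) = T (PowerSeries.coeff n f) := by
  simp [coeffMap]

/-- A biadditive map extended to power series. -/
noncomputable def coeffMap₂ {A : Type*} [CommRing A] (T : A →+ A →+ A) :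
    PowerSeries A →+ PowerSeries A →+ PowerSeries A :=
  AddMonoidHom.mk' (fun f => AddMonoidHom.mk' (fun g => PowerSeries.mk fun n =>
    ∑ p ∈ antidiagonal n, T (PowerSeries.coeff p.1 f) (PowerSeries.coeff p.2 g))
    fun g g' => by ext1 n; simp [Finset.sum_add_distrib]) fun f f' => by
      refine AddMonoidHom.ext fun g => PowerSeries.ext fun n => ?_
      simp [Finset.sum_add_distrib]

theorem coeff_coeffMap₂ {A : Type*} [CommRing A] (T : A →+ A →+ A) (n : ℕ) (f g : PowerSeries A) :
    PowerSeries.coeff n (coeffMap₂ T f g) =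
      ∑ p ∈ antidiagonal n, T (PowerSeries.coeff p.1 f) (PowerSeries.coeff p.2 g) := by
  simp [coeffMap₂]

/-- `∂` on power series with differential polynomials as coefficients. -/
noncomputable def psD : PowerSeries (Jet K (Fin 1)) →+ PowerSeries (Jet K (Fin 1)) :=
  coeffMap (D (Fin 1)).toLinearMap.toAddMonoidHom

/-- `adjFrechet` on power series with differential polynomials as coefficients. -/
noncomputable def psL :
    PowerSeries (Jet K (Fin 1)) →+ PowerSeries (Jet K (Fin 1)) →+ PowerSeries (Jet K (Fin 1)) :=
  coeffMap₂ (adjFrechetHom (0 : Derivation K K K) 0)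

theorem coeff_psD (n : ℕ) (f : PowerSeries (Jet K (Fin 1))) :
    PowerSeries.coeff n (psD f) = D (Fin 1) (PowerSeries.coeff n f) :=
  coeff_coeffMap _ _ _

theorem psD_mul (f g : PowerSeries (Jet K (Fin 1))) : psD (f * g) = f * psD g + g * psD f := by
  ext1 n
  rw [mul_comm g]
  simp only [coeff_psD, PowerSeries.coeff_mul, map_add, map_sum, Derivation.leibniz, smul_eq_mul,
    Finset.sum_add_distrib]
  simp only [mul_comm]

theorem psD_C (f : Jet K (Fin 1)) : psD (PowerSeries.C f) = PowerSeries.C (D (Fin 1) f) := by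
  ext1 n
  simp only [coeff_psD, PowerSeries.coeff_C]
  split_ifs <;> simp

theorem psD_X : psD (PowerSeries.X : PowerSeries (Jet K (Fin 1))) = 0 := by
  ext1 n
  simp only [coeff_psD, PowerSeries.coeff_X]
  split_ifs <;> simp

theorem psD_natCast (n : ℕ) : psD (n : PowerSeries (Jet K (Fin 1))) = 0 := by
  rw [← map_natCast (PowerSeries.C (R := Jet K (Fin 1))) n, psD_C, Derivation.map_natCast, map_zero]

theorem psD_ofNat (n : ℕ) [n.AtLeastTwo] :
    psD (OfNat.ofNat n : PowerSeries (Jet K (Fin 1))) = 0 :=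
  psD_natCast n

theorem psD_derivative (f : PowerSeries (Jet K (Fin 1))) :
    psD (PowerSeries.derivative _ f) = PowerSeries.derivative _ (psD f) := by
  ext1 n
  simp only [coeff_psD, PowerSeries.coeff_derivative, Derivation.leibniz, smul_eq_mul]
  simp [mul_comm]

theorem sum_antidiagonal_assoc {A : Type*} [AddCommMonoid A] (T : ℕ → ℕ → ℕ → A) (n : ℕ) :
    ∑ p ∈ antidiagonal n, ∑ q ∈ antidiagonal p.1, T q.1 q.2 p.2 =
      ∑ p ∈ antidiagonal n, ∑ q ∈ antidiagonal p.2, T p.1 q.1 q.2 := by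
  simp only [Finset.sum_sigma']
  refine Finset.sum_nbij' (fun x ↦ ⟨(x.2.1, x.2.2 + x.1.2), (x.2.2, x.1.2)⟩)
    (fun x ↦ ⟨(x.1.1 + x.2.1, x.2.2), (x.1.1, x.2.1)⟩) ?_ ?_ ?_ ?_ (fun _ _ => rfl) <;>
  · rintro ⟨⟨a, b⟩, ⟨c, e⟩⟩ h
    simp only [Finset.mem_sigma, mem_antidiagonal] at h ⊢
    obtain ⟨h1, h2⟩ := h
    subst h2
    simp <;> omega

theorem psL_psD (G f : PowerSeries (Jet K (Fin 1))) : psL (psD G) f = psL G (-psD f) := by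
  ext1 n
  rw [psL, coeff_coeffMap₂, coeff_coeffMap₂]
  refine Finset.sum_congr rfl fun p _ => ?_
  rw [map_neg, coeff_psD, coeff_psD]
  exact adjFrechet_totalDeriv _ _ _ _

/-- The product rule holds coefficientwise; associativity of the Cauchy product regroups the triple
sums. -/
theorem coeffMap₂_mul {A : Type*} [CommRing A] {T : A →+ A →+ A}
    (hT : ∀ a b f, T (a * b) f = T a (b * f) + T b (a * f)) (G G' f : PowerSeries A) :
    coeffMap₂ T (G * G') f = coeffMap₂ T G (G' * f) + coeffMap₂ T G' (G * f) := by
  ext1 n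
  rw [map_add]
  simp only [coeff_coeffMap₂, PowerSeries.coeff_mul, map_sum, AddMonoidHom.finsetSum_apply, hT,
    Finset.sum_add_distrib]
  congr 1
  · exact sum_antidiagonal_assoc (fun a b c => T
      (PowerSeries.coeff a G) (PowerSeries.coeff b G' * PowerSeries.coeff c f)) n
  · rw [← sum_antidiagonal_assoc (fun a b c => T
      (PowerSeries.coeff a G') (PowerSeries.coeff b G * PowerSeries.coeff c f)) n]
    refine Finset.sum_congr rfl fun p _ => ?_
    exact (Finset.Nat.sum_antidiagonal_swap (f := fun q => T (PowerSeries.coeff q.1 G')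
      (PowerSeries.coeff q.2 G * PowerSeries.coeff p.2 f)))

theorem psL_mul (G G' f : PowerSeries (Jet K (Fin 1))) :
    psL (G * G') f = psL G (G' * f) + psL G' (G * f) :=
  coeffMap₂_mul (adjFrechet_mul (0 : Derivation K K K) 0) G G' f

theorem psL_C (G : Jet K (Fin 1)) (f : PowerSeries (Jet K (Fin 1))) :
    psL (PowerSeries.C G) f = coeffMap (adjFrechetHom (0 : Derivation K K K) 0 G) f := by
  ext1 n
  rw [psL, coeff_coeffMap₂, coeff_coeffMap, Finset.sum_eq_single (0, n)]
  · simp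
  · rintro ⟨a, b⟩ hab hne
    rw [mem_antidiagonal] at hab
    have : a ≠ 0 := by rintro rfl; simp at hab; simp [hab] at hne
    simp [PowerSeries.coeff_C, this]
  · simp

theorem psL_X (f : PowerSeries (Jet K (Fin 1))) : psL PowerSeries.X f = 0 := by
  ext1 n
  rw [psL, coeff_coeffMap₂, map_zero]
  refine Finset.sum_eq_zero fun p _ => ?_
  rw [PowerSeries.coeff_X]
  split_ifs
  · exact adjFrechet_C (0 : Derivation K K K) _ 1 _
  · simp

theorem psL_natCast (n : ℕ) (f : PowerSeries (Jet K (Fin 1))) : psL (n : PowerSeries _) f = 0 := by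
  rw [← map_natCast (PowerSeries.C (R := Jet K (Fin 1))) n, psL_C]
  ext1 m
  rw [coeff_coeffMap, ← map_natCast (C (σ := Fin 1 × ℕ) (R := K)), map_zero]
  exact adjFrechet_C (0 : Derivation K K K) _ _ _

theorem coeff_psL_one (n : ℕ) (G : PowerSeries (Jet K (Fin 1))) :
    PowerSeries.coeff n (psL G 1) = varDeriv (0 : Derivation K K K) (PowerSeries.coeff n G) 0 := by
  rw [varDeriv_eq, psL, coeff_coeffMap₂, Finset.sum_eq_single (n, 0)]
  · simp [adjFrechetHom_apply]
  · rintro ⟨a, b⟩ hab hne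
    rw [mem_antidiagonal] at hab
    have : b ≠ 0 := by rintro rfl; simp at hab; simp [hab] at hne
    simp [PowerSeries.coeff_one, this]
  · simp

end PowerSeries

/-! ### Variational derivatives of the KdV sequence -/

section VariationalDerivative

variable {K : Type*} [Field K] [CharZero K]

/-- The generating series of the `h_n`. -/
noncomputable def kdvGen (K : Type*) [Field K] : PowerSeries (Jet K (Fin 1)) :=
  PowerSeries.mk kdvSeq

theorem psD_kdvGen : psD (kdvGen K) = PowerSeries.X *
    (psD (psD (psD (kdvGen K))) + 4 * PowerSeries.C (X (0, 0)) * psD (kdvGen K)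
      + 2 * psD (PowerSeries.C (X (0, 0))) * kdvGen K) := by
  have h4 : (4 : PowerSeries (Jet K (Fin 1))) = PowerSeries.C 4 := (map_ofNat _ 4).symm
  have h2 : (2 : PowerSeries (Jet K (Fin 1))) = PowerSeries.C 2 := (map_ofNat _ 2).symm
  ext1 n
  cases n with
  | zero => simp [coeff_psD, kdvGen, D_kdvSeq_zero]
  | succ n =>
    rw [coeff_psD, PowerSeries.coeff_succ_X_mul, kdvGen, PowerSeries.coeff_mk, ← kdvOp_kdvSeq]
    simp only [psD_C, h4, h2, mul_assoc, map_add, PowerSeries.coeff_C_mul, coeff_psD,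
      PowerSeries.coeff_mk, kdvOp, Derivation.leibniz, smul_eq_mul]
    ring

theorem kdvGen_quadratic :
    4 * (PowerSeries.X * (2 * kdvGen K * psD (psD (kdvGen K)) - psD (kdvGen K) ^ 2
      + 4 * PowerSeries.C (X (0, 0)) * kdvGen K ^ 2) - kdvGen K ^ 2) = -1 := by
  set h := kdvGen K with hh
  set F := 4 * (PowerSeries.X * (2 * h * psD (psD h) - psD h ^ 2
      + 4 * PowerSeries.C (X (0, 0)) * h ^ 2) - h ^ 2) with hF
  have h1 : psD F = 0 := by
    have e : psD F = 8 * h * (PowerSeries.X *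
      (psD (psD (psD h)) + 4 * PowerSeries.C (X (0, 0)) * psD h
      + 2 * psD (PowerSeries.C (X (0, 0))) * h) - psD h) := by
      simp only [hF, psD_mul, map_sub, map_add, psD_X, psD_ofNat 4, psD_ofNat 2, sq]
      ring
    rw [e, ← psD_kdvGen, sub_self, mul_zero]
  have h2 : F = PowerSeries.map C (PowerSeries.map constantCoeff F) := by
    ext1 n
    rw [PowerSeries.coeff_map, PowerSeries.coeff_map]
    refine eq_C_of_D_eq_zero ?_
    rw [← coeff_psD, h1, map_zero]
  -- `F` has constant coefficients, so it equals its own constant terms. There all derivatives and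
  -- `u` vanish, leaving `-4 (1/2)² = -1`.
  have hD : ∀ f : PowerSeries (Jet K (Fin 1)), PowerSeries.map constantCoeff (psD f) = 0 := by
    intro f
    ext1 n
    rw [PowerSeries.coeff_map, coeff_psD, constantCoeff_D, map_zero]
  have h3 : PowerSeries.map constantCoeff h = PowerSeries.C (1 / 2) := by
    ext1 n
    rw [PowerSeries.coeff_map, hh, kdvGen, PowerSeries.coeff_mk, PowerSeries.coeff_C]
    cases n with
    | zero => simp [kdvSeq_zero]
    | succ n => simp [constantCoeff_kdvSeq_succ]
  have h4 : (4 : PowerSeries (Jet K (Fin 1))) * PowerSeries.C (C (1 / 2)) ^ 2 = 1 := by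
    rw [← map_ofNat (PowerSeries.C (R := Jet K (Fin 1))) 4,
      ← map_ofNat (C (R := K) (σ := Fin 1 × ℕ)) 4, ← map_pow, ← map_pow, ← map_mul, ← map_mul]
    norm_num
  rw [h2, hF]
  simp only [map_mul, map_sub, map_add, map_pow, hD, h3, map_ofNat, PowerSeries.map_X,
    PowerSeries.map_C, constantCoeff_X, map_zero]
  linear_combination -h4

theorem exists_kdvGen_mul_eq_one : ∃ g, kdvGen K * g = 1 := by
  refine IsUnit.exists_right_inv (PowerSeries.isUnit_iff_constantCoeff.2 ?_)
  rw [← PowerSeries.coeff_zero_eq_constantCoeff_apply, kdvGen, PowerSeries.coeff_mk, kdvSeq_zero]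
  exact (isUnit_iff_ne_zero.2 (by norm_num)).map C

/-- Applying `G ↦ L_G(g)` to the quadratic relation gives `L_h` of the adjoint linearization at `g`,
plus the explicit `u`-term `16zh`. That linearization equals `-2g²`, and `L_{hg}(g) = 0` gives
`L_h(g²) = -L_g(1)`. -/
theorem psL_kdvGen_inv {g : PowerSeries (Jet K (Fin 1))} (hg : kdvGen K * g = 1) :
    psL g 1 = -(8 * PowerSeries.X * kdvGen K) := by
  have hE := kdvGen_quadratic (K := K)
  set h := kdvGen K with hh
  set u : PowerSeries (Jet K (Fin 1)) := PowerSeries.C (X (0, 0)) with hu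
  have hone : ∀ f, psL (1 : PowerSeries (Jet K (Fin 1))) f = 0 := fun f => by
    simpa using psL_natCast 1 f
  have hconst : ∀ (n : ℕ) [n.AtLeastTwo] (G f : PowerSeries (Jet K (Fin 1))),
      psL (ofNat(n) * G) f = psL G (ofNat(n) * f) := fun n _ G f => by
    rw [psL_mul, show psL (ofNat(n) : PowerSeries (Jet K (Fin 1))) (G * f) = 0 from
      psL_natCast n _, zero_add]
  have hX : ∀ G f : PowerSeries (Jet K (Fin 1)),
      psL (PowerSeries.X * G) f = psL G (PowerSeries.X * f) := fun G f => by
    rw [psL_mul, psL_X, zero_add]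
  have hpsu : ∀ f, psL u f = f := fun f => by
    ext1 n
    rw [hu, psL_C, coeff_coeffMap, adjFrechetHom_apply, adjFrechet_X]
    simp
  have h0 := congrArg (fun G => psL G g) hE
  simp only [map_neg, AddMonoidHom.neg_apply, hone, neg_zero, mul_assoc, hconst, map_sub,
    map_add, AddMonoidHom.sub_apply, AddMonoidHom.add_apply, hX, sq, psL_mul, psL_psD, neg_neg,
    hpsu] at h0
  have hDg : psD g = -(psD h * g ^ 2) := by
    have h1 := congrArg psD hg
    rw [psD_mul, show psD (1 : PowerSeries (Jet K (Fin 1))) = 0 by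
      simpa using psD_natCast (K := K) 1] at h1
    linear_combination g * h1 - psD g * hg
  have e1 : psD (psD (h * (2 * (PowerSeries.X * (4 * g))))) = 0 := by
    rw [show h * (2 * (PowerSeries.X * (4 * g))) = 8 * PowerSeries.X by
      linear_combination 8 * PowerSeries.X * hg, psD_mul, psD_X, psD_ofNat 8]
    simp
  have e2 : psD (psD h * (PowerSeries.X * (4 * g)))
      = 4 * PowerSeries.X * (psD (psD h) * g - psD h ^ 2 * g ^ 2) := by
    rw [psD_mul, psD_mul, psD_mul, psD_X, psD_ofNat 4, hDg]
    ring
  -- All terms but the final `g * g + g * g` are the argument of `L_h` in `h0`; the quadratic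
  -- relation and `h g = 1` reduce them to `-2g²`.
  have key : psD (psD h) * (2 * (PowerSeries.X * (4 * g)))
      + psD (psD (h * (2 * (PowerSeries.X * (4 * g)))))
      + (psD (psD h * (PowerSeries.X * (4 * g))) + psD (psD h * (PowerSeries.X * (4 * g))))
      + (h * (u * (4 * (PowerSeries.X * (4 * g)))) + h * (u * (4 * (PowerSeries.X * (4 * g)))))
      - (h * (4 * g) + h * (4 * g)) + (g * g + g * g) = 0 := by
    rw [e1, e2]
    linear_combination 2 * g ^ 2 * hE + (8 * (h * g) - 16 * PowerSeries.X * psD (psD h) * g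
      - 32 * PowerSeries.X * u * (h * g)) * hg
  have h1 := congrArg (psL h) key
  simp only [map_add, map_sub, map_zero] at h1
  have h2 : psL (h * g) g = 0 := by rw [hg, hone]
  rw [psL_mul, hg] at h2
  have h3 : 2 * (psL g 1 + 8 * PowerSeries.X * h) = 0 := by
    linear_combination 2 * h2 + h0 - h1 - 16 * PowerSeries.X * h * hg
  have h4 : (2 : PowerSeries (Jet K (Fin 1))) ≠ 0 := by
    rw [← map_ofNat (PowerSeries.C (R := Jet K (Fin 1))) 2,
      ← map_ofNat (C (R := K) (σ := Fin 1 × ℕ)) 2, Ne, map_eq_zero_iff _ PowerSeries.C_injective,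
      map_eq_zero_iff _ (C_injective _ _)]
    norm_num
  linear_combination (mul_eq_zero.1 h3).resolve_left h4

theorem varDeriv_kdvSeq_succ (n : ℕ) :
    varDeriv (0 : Derivation K K K) (kdvSeq (n + 1)) 0 = ((4 * n + 2 : ℕ) : Jet K (Fin 1)) * kdvSeq n := by
  obtain ⟨g, hg⟩ := exists_kdvGen_mul_eq_one (K := K)
  have hE := kdvGen_quadratic (K := K)
  have hL := psL_kdvGen_inv hg
  set h := kdvGen K with hh
  let dt := PowerSeries.derivative (Jet K (Fin 1))
  set w := dt h with hw
  have hDg : psD g = -(psD h * g ^ 2) := by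
    have h1 := congrArg psD hg
    rw [psD_mul, show psD (1 : PowerSeries (Jet K (Fin 1))) = 0 by
      simpa using psD_natCast (K := K) 1] at h1
    linear_combination g * h1 - psD g * hg
  have hdg : dt g = -(w * g ^ 2) := by
    have h1 := congrArg dt hg
    rw [Derivation.leibniz, Derivation.map_one_eq_zero, smul_eq_mul, smul_eq_mul, ← hw] at h1
    linear_combination g * h1 - dt g * hg
  have hdE := congrArg dt hE
  have hd4 : dt 4 = 0 := dt.map_natCast 4
  have hd2 : dt 2 = 0 := dt.map_natCast 2
  have hdX : dt PowerSeries.X = 1 := PowerSeries.derivative_X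
  have hdC : dt (PowerSeries.C (X (0, 0))) = 0 := PowerSeries.derivative_C
  have hdD : ∀ f, dt (psD f) = psD (dt f) := fun f => (psD_derivative f).symm
  simp only [Derivation.leibniz, sq, map_sub, map_add, map_neg, smul_eq_mul, hd4, hd2, hdX, hdC,
    hdD, ← hw, Derivation.map_one_eq_zero] at hdE
  -- Obtained from the quadratic relation and its `z`-derivative, multiplied by powers of `g` and
  -- `z` and reduced by `h g = 1`. Applying `δ` to the coefficient of `z^{n+1}` gives `4 δh_{n+1} +
  -- (2n+1) δg_{n+1} = 0`.
  have hrel : 4 * h - g + PowerSeries.X * (2 * dt g)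
      + psD (4 * PowerSeries.X ^ 2 * (2 * psD w - 2 * w * psD h * g)) = 0 := by
    simp only [psD_mul, sq, map_sub, psD_X, psD_ofNat 4, psD_ofNat 2, hDg, hdg]
    linear_combination -g * hE + PowerSeries.X * g * hdE
      - 2 * PowerSeries.X * w * g ^ 2 * hE + (-(4 * h) - 8 * PowerSeries.X ^ 2 * psD (psD w)
        + 16 * PowerSeries.X ^ 2 * w * g * psD (psD h)
        + 32 * PowerSeries.C (X (0, 0)) * PowerSeries.X ^ 2 * w * (h * g)
        - 8 * PowerSeries.X * w * (h * g)) * hg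
  let δ : Jet K (Fin 1) →+ Jet K (Fin 1) := (adjFrechetHom (0 : Derivation K K K) 0).flip 1
  have hδ : ∀ f, δ f = varDeriv 0 f 0 := fun f => (varDeriv_eq 0 f 0).symm
  have hδD : ∀ f, δ (D (Fin 1) f) = 0 := fun f => by
    refine (adjFrechet_totalDeriv 0 0 f 1).trans ?_
    simp [adjFrechet_zero_right]
  have h4 : (4 : PowerSeries (Jet K (Fin 1))) = PowerSeries.C 4 := (map_ofNat _ 4).symm
  have h2 : (2 : PowerSeries (Jet K (Fin 1))) = PowerSeries.C 2 := (map_ofNat _ 2).symm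
  have h8 : (8 : PowerSeries (Jet K (Fin 1))) = PowerSeries.C 8 := (map_ofNat _ 8).symm
  have hgn : δ (PowerSeries.coeff (n + 1) g) = -(8 * kdvSeq n) := by
    rw [hδ, ← coeff_psL_one, hL, map_neg, mul_assoc, h8, PowerSeries.coeff_C_mul,
      PowerSeries.coeff_succ_X_mul, hh, kdvGen, PowerSeries.coeff_mk]
  have hc := congrArg (fun f => δ (PowerSeries.coeff (n + 1) f)) hrel
  have hhn : PowerSeries.coeff (n + 1) (4 * h) = 4 • kdvSeq (n + 1) := by
    rw [h4, PowerSeries.coeff_C_mul, hh, kdvGen, PowerSeries.coeff_mk]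
    simp
  have hdn : PowerSeries.coeff (n + 1) (PowerSeries.X * (2 * dt g))
      = (2 * (n + 1)) • PowerSeries.coeff (n + 1) g := by
    rw [PowerSeries.coeff_succ_X_mul, h2, PowerSeries.coeff_C_mul, PowerSeries.coeff_derivative]
    simp; ring
  simp only [map_add, map_sub, coeff_psD, hδD, hhn, hdn, map_nsmul, hgn, map_zero, add_zero] at hc
  have hc' : (4 : Jet K (Fin 1)) * (δ (kdvSeq (n + 1)) - ((4 * n + 2 : ℕ) : Jet K (Fin 1)) * kdvSeq n) = 0 := by
    simp only [nsmul_eq_mul] at hc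
    push_cast at hc ⊢
    linear_combination hc
  have h40 : (4 : Jet K (Fin 1)) ≠ 0 := by
    rw [← map_ofNat (C (R := K) (σ := Fin 1 × ℕ)) 4, Ne, map_eq_zero_iff _ (C_injective _ _)]
    norm_num
  rw [← hδ]
  exact sub_eq_zero.1 ((mul_eq_zero.1 hc').resolve_left h40)

end VariationalDerivative

/-! ### Differential polynomials in `u` inside those in `u` and `φ` -/

section Inclusion

variable {K : Type*} [Field K]

theorem inclU_X (p : Fin 1 × ℕ) : inclU (X p : Jet K (Fin 1)) = X (0, p.2) := by
  simp [inclU]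

theorem inclU_C (a : K) : inclU (C a) = C a := by
  simp [inclU]

theorem injective_inclU : Function.Injective (inclU (K := K)) := by
  refine rename_injective _ fun p q h => ?_
  obtain ⟨i, n⟩ := p
  obtain ⟨j, m⟩ := q
  simp only [Prod.mk.injEq, true_and] at h
  rw [Subsingleton.elim i j, h]

theorem inclU_D (f : Jet K (Fin 1)) : inclU (D (Fin 1) f) = D (Fin 2) (inclU f) := by
  induction f using MvPolynomial.induction_on with
  | C a => rw [D_C, inclU_C, D_C, map_zero]
  | add p q hp hq => simp only [map_add, hp, hq]
  | mul_X p n hp =>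
    simp only [Derivation.leibniz, smul_eq_mul, map_add, map_mul, hp, inclU_X, totalDeriv_X]

theorem inclU_iterate_D (n : ℕ) (f : Jet K (Fin 1)) :
    inclU ((D (Fin 1))^[n] f) = (D (Fin 2))^[n] (inclU f) := by
  induction n with
  | zero => rfl
  | succ n ih => rw [Function.iterate_succ_apply', inclU_D, ih, Function.iterate_succ_apply']

/-- On polynomials in `u` alone the `φ`-component of a flow is invisible, so brackets of extended
Hamiltonians are those of KdV. -/
theorem evol_inclU (G f : Jet K (Fin 1)) (F : Jet K (Fin 2)) :
    evol (0 : Derivation K K K) ![inclU G, F] (inclU f) =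
      inclU (evol (0 : Derivation K K K) (fun _ => G) f) := by
  induction f using MvPolynomial.induction_on with
  | C a =>
    have h : ∀ {ι : Type} (P : ι → Jet K ι), evol (0 : Derivation K K K) P (C a) = 0 :=
      fun P => derivation_C _ _
    rw [inclU_C, h, h, map_zero]
  | add p q hp hq => simp only [map_add, hp, hq]
  | mul_X p n hp =>
    obtain ⟨i, n⟩ := n
    simp only [Derivation.leibniz, smul_eq_mul, map_add, map_mul, hp, inclU_X, evol_X]
    rw [inclU_iterate_D]
    rfl

theorem pderiv_one_inclU (n : ℕ) (f : Jet K (Fin 1)) : pderiv (1, n) (inclU f) = 0 := by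
  induction f using MvPolynomial.induction_on with
  | C a => rw [inclU_C, pderiv_C]
  | add p q hp hq => simp only [map_add, hp, hq, add_zero]
  | mul_X p m hp =>
    rw [map_mul, pderiv_mul, hp, inclU_X, pderiv_X_of_ne (by simp)]
    simp

theorem pderiv_zero_inclU (n : ℕ) (f : Jet K (Fin 1)) :
    pderiv (0, n) (inclU f) = inclU (pderiv (0, n) f) := by
  classical
  induction f using MvPolynomial.induction_on with
  | C a => rw [inclU_C, pderiv_C, pderiv_C, map_zero]
  | add p q hp hq => simp only [map_add, hp, hq]
  | mul_X p m hp =>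
    obtain ⟨i, m⟩ := m
    rw [map_mul, pderiv_mul, pderiv_mul, hp, inclU_X, map_add, map_mul, map_mul, inclU_X]
    congr 2
    rw [pderiv_X, pderiv_X, Subsingleton.elim i 0]
    by_cases h : m = n
    · subst h; simp
    · rw [Pi.single_eq_of_ne (by simp [h]), Pi.single_eq_of_ne (by simp [h]), map_zero]

theorem varDeriv_inclU_zero (f : Jet K (Fin 1)) :
    varDeriv (0 : Derivation K K K) (inclU f) 0 =
      inclU (varDeriv (0 : Derivation K K K) f 0) := by
  obtain ⟨N, hN⟩ := exists_forall_pderiv_eq_zero (0 : Fin 1) f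
  have hN' : ∀ n, N ≤ n → pderiv (0, n) (inclU f) = 0 := fun n hn => by
    rw [pderiv_zero_inclU, hN n hn, map_zero]
  rw [varDeriv_eq, varDeriv_eq, adjFrechet_eq_sum _ _ hN, adjFrechet_eq_sum _ _ hN', map_sum]
  refine Finset.sum_congr rfl fun n _ => ?_
  rw [map_mul, inclU_iterate_D, pderiv_zero_inclU, mul_one, mul_one, map_pow, map_neg, map_one]

theorem varDeriv_inclU_one (f : Jet K (Fin 1)) :
    varDeriv (0 : Derivation K K K) (inclU f) 1 = 0 := by
  rw [varDeriv_eq, adjFrechet_eq_sum _ _ (N := 0) fun n _ => pderiv_one_inclU n f]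
  simp

theorem EqModDiv.inclU {f g : Jet K (Fin 1)} (h : EqModDiv (0 : Derivation K K K) f g) :
    EqModDiv (0 : Derivation K K K) (inclU f) (inclU g) := by
  obtain ⟨E, hE⟩ := h
  exact ⟨KdVExt.inclU E, by rw [← map_sub, hE, inclU_D]⟩

theorem applyPhi_single (s : ℕ) (f : Jet K (Fin 1)) :
    applyPhi (Finsupp.single s f) = inclU f * X (1, s) := by
  simp [applyPhi]

theorem applyPhi_add (R S : DiffOp K) : applyPhi (R + S) = applyPhi R + applyPhi S :=
  Finsupp.sum_add_index' (by simp) (by intros; rw [map_add, add_mul])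

theorem applyPhi_firstOrderOp (α : K) (f : Jet K (Fin 1)) :
    applyPhi (firstOrderOp α f) = algebraMap K _ α * D (Fin 2) (inclU f) * X (1, 0)
      + 2 * inclU f * X (1, 1) := by
  rw [firstOrderOp, applyPhi_add, applyPhi_single, applyPhi_single, smul_jet, map_mul, inclU_D,
    map_mul, map_ofNat]
  congr 3
  exact inclU_C α

end Inclusion

/-! ### Hamiltonians in involution and commuting extended flows -/

section Hamiltonians

variable {K : Type*} [Field K] [CharZero K]

/-- The Hamiltonians `H_n` with `δH_n/δu = h_n`. -/
noncomputable def kdvHam (n : ℕ) : Jet K (Fin 1) :=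
  C ((4 * n + 2 : ℕ) : K)⁻¹ * kdvSeq (n + 1)

theorem varDeriv_kdvHam (n : ℕ) :
    varDeriv (0 : Derivation K K K) (kdvHam n) 0 = kdvSeq n := by
  have h1 : varDeriv (0 : Derivation K K K) (kdvHam n : Jet K (Fin 1)) 0
      = C ((4 * n + 2 : ℕ) : K)⁻¹ * varDeriv (0 : Derivation K K K) (kdvSeq (n + 1)) 0 := by
    obtain ⟨N, hN⟩ := exists_forall_pderiv_eq_zero (0 : Fin 1) (kdvSeq (n + 1) : Jet K (Fin 1))
    have hN' : ∀ m, N ≤ m → pderiv (0, m) (kdvHam n : Jet K (Fin 1)) = 0 := fun m hm => by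
      rw [kdvHam, pderiv_C_mul, hN m hm, mul_zero]
    have hit : ∀ (c : K) (m : ℕ) (f : Jet K (Fin 1)),
        (D (Fin 1))^[m] (C c * f) = C c * (D (Fin 1))^[m] f := by
      intro c m f
      induction m with
      | zero => rfl
      | succ m ih => rw [Function.iterate_succ_apply', ih, Derivation.leibniz, D_C,
          Function.iterate_succ_apply']; simp
    rw [varDeriv_eq, varDeriv_eq, adjFrechet_eq_sum _ _ hN, adjFrechet_eq_sum _ _ hN',
      Finset.mul_sum]
    refine Finset.sum_congr rfl fun m _ => ?_
    rw [kdvHam, pderiv_C_mul, mul_one, mul_one, hit]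
    ring
  rw [h1, varDeriv_kdvSeq_succ, ← mul_assoc, ← map_natCast (C (R := K) (σ := Fin 1 × ℕ)), ← C_mul,
    inv_mul_cancel₀ (Nat.cast_ne_zero.2 (by omega)), C_1, one_mul]

/-- Lenard scheme: `h_n ∂h_{m+1} = h_n P(h_m) ∼ -h_m P(h_n) = -h_m ∂h_{n+1} ∼ h_{n+1} ∂h_m`.
Repeating this lowers `m` to zero, where `∂h_0 = 0`. -/
theorem kdvSeq_mul_D_kdvSeq (m n : ℕ) :
    EqModDiv (0 : Derivation K K K) (kdvSeq n * D (Fin 1) (kdvSeq m) : Jet K (Fin 1)) 0 := by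
  induction m generalizing n with
  | zero => exact .of_eq (by rw [D_kdvSeq_zero, mul_zero])
  | succ m ih =>
    refine EqModDiv.trans ⟨kdvQuad (kdvSeq n) (kdvSeq m) - kdvSeq (n + 1) * kdvSeq m, ?_⟩
      (ih (n + 1))
    rw [map_sub, D_kdvQuad, kdvOp_kdvSeq, kdvOp_kdvSeq, Derivation.leibniz, smul_eq_mul,
      smul_eq_mul]
    ring

theorem matApply_kdvMatrix (P : Fin 1 → Jet K (Fin 1)) (i : Fin 1) :
    matApply (kdvMatrix (0 : Derivation K K K)) P i = kdvOp (P 0) := by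
  have e1 : algebraMap K (Jet K (Fin 1)) 2 = 2 := map_ofNat _ 2
  have e2 : algebraMap K (Jet K (Fin 1)) 2 * algebraMap K (Jet K (Fin 1)) (1 / 2) = 1 := by
    rw [← map_mul]; norm_num
  rw [Subsingleton.elim i 0]
  simp only [matApply, kdvMatrix, dOp, mulOp, pow_succ, pow_zero, one_mul, Fin.sum_univ_one,
    Matrix.of_apply, Matrix.cons_val_fin_one,
    LinearMap.smul_apply, LinearMap.add_apply, Module.End.mul_apply,
    LinearMap.mulLeft_apply, Derivation.coeFn_coe, smul_jet, kdvOp]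
  rw [e1] at e2 ⊢
  linear_combination D (Fin 1) (D (Fin 1) (D (Fin 1) (P 0))) * e2

theorem hamField_kdvMatrix (n : ℕ) :
    hamField 0 (kdvMatrix (0 : Derivation K K K)) (kdvHam n) =
      evol (0 : Derivation K K K) fun _ => D (Fin 1) (kdvSeq (n + 1)) := by
  rw [hamField]
  congr 1
  ext1 i
  rw [matApply_kdvMatrix, varDeriv_kdvHam, kdvOp_kdvSeq]

theorem bracket_kdvHam (m n : ℕ) : EqModDiv (0 : Derivation K K K)
    (bracket 0 (kdvMatrix (0 : Derivation K K K)) (kdvHam m) (kdvHam n)) 0 := by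
  rw [bracket, hamField_kdvMatrix]
  refine (evol_eqModDiv _ _ _).trans ((EqModDiv.of_eq ?_).trans (kdvSeq_mul_D_kdvSeq (m + 1) n))
  rw [Fin.sum_univ_one, varDeriv_kdvHam, mul_comm]

theorem extKdV_eq_hamField (α : K) (n : ℕ) : extKdV α kdvSeq n =
    hamField 0 (extMatrix (0 : Derivation K K K) α) (inclU (kdvHam n)) := by
  rw [extKdV, linExt, hamField]
  congr 1
  ext1 i
  fin_cases i
  · simp only [Fin.zero_eta, Matrix.cons_val_zero, matApply_extMatrix_zero, varDeriv_inclU_zero,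
      varDeriv_inclU_one, varDeriv_kdvHam, ← kdvOp_kdvSeq, kdvOp, map_add, map_mul, inclU_D,
      map_ofNat, inclU_X, mul_zero, map_zero, Derivation.leibniz, smul_eq_mul, totalDeriv_X]
    ring
  · simp only [Fin.mk_one, Matrix.cons_val_one, Matrix.cons_val_zero, matApply_extMatrix_one,
      varDeriv_inclU_zero, varDeriv_kdvHam, applyPhi_firstOrderOp]
    ring

omit [CharZero K] in
theorem hamField_eq_zero {ι : Type*} [Fintype ι] {H : Jet K ι}
    (B : Matrix ι ι (Module.End K (Jet K ι))) (h : EqModDiv (0 : Derivation K K K) H 0) :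
    hamField (0 : Derivation K K K) B H = 0 := by
  rw [hamField, evol_eq_zero_iff]
  have h1 : varDeriv (0 : Derivation K K K) H = 0 := by
    ext1 i
    rw [varDeriv_eq, h.adjFrechet_one, ← C_0, adjFrechet_C, Pi.zero_apply]
  ext1 i
  simp [matApply, h1]

/-- The commutator is the Hamiltonian field of the bracket, and that bracket is the image of a KdV
bracket, hence a total derivative. -/
theorem lie_extKdV (α : K) (m n : ℕ) : ⁅extKdV α kdvSeq m, extKdV α kdvSeq n⁆ = 0 := by
  rw [extKdV_eq_hamField α m, extKdV_eq_hamField α n,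
    (isHamiltonian_extMatrix (0 : Derivation K K K) α).commutator]
  refine hamField_eq_zero _ ?_
  rw [bracket, ← extKdV_eq_hamField, extKdV, linExt, evol_inclU, ← hamField_kdvMatrix]
  have h := (bracket_kdvHam (K := K) m n).inclU
  rw [map_zero] at h
  exact h

theorem extKdV_one (α : K) : extKdV α kdvSeq 1 = extKdV₂ α := by
  rw [extKdV, extKdV₂, ← kdvOp_kdvSeq, kdvSeq_one]
  congr 1
  simp only [kdvOp, sq, map_add, Derivation.leibniz, smul_eq_mul, totalDeriv_X, D_ofNat 3]
  ring

end Hamiltonians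

/-! ### Rank homogeneity -/

section Rank

variable {K : Type*} [Field K]

theorem isWeightedHomogeneous_D {f : Jet K (Fin 1)} {n : ℕ}
    (hf : IsWeightedHomogeneous (fun p : Fin 1 × ℕ => p.2 + 2) f n) :
    IsWeightedHomogeneous (fun p : Fin 1 × ℕ => p.2 + 2) (D (Fin 1) f) (n + 1) := by
  set w := fun p : Fin 1 × ℕ => p.2 + 2
  have key : ∀ (s : Fin 1 × ℕ →₀ ℕ) (r : K),
      IsWeightedHomogeneous w (D (Fin 1) (monomial s r)) (Finsupp.weight w s + 1) := by
    intro s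
    -- By the Leibniz rule the claim for two exponents implies it for their sum, which leaves
    -- constants and single variables.
    have hadd : ∀ s t : Fin 1 × ℕ →₀ ℕ,
        (∀ r : K, IsWeightedHomogeneous w (D (Fin 1) (monomial s r)) (Finsupp.weight w s + 1)) →
        (∀ r : K, IsWeightedHomogeneous w (D (Fin 1) (monomial t r)) (Finsupp.weight w t + 1)) →
        ∀ r : K, IsWeightedHomogeneous w (D (Fin 1) (monomial (s + t) r))
          (Finsupp.weight w (s + t) + 1) := by
      intro s t hs ht r
      rw [← mul_one r, ← monomial_mul, Derivation.leibniz, smul_eq_mul, smul_eq_mul, map_add]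
      refine IsWeightedHomogeneous.add ?_ ?_
      · rw [add_assoc]
        exact (isWeightedHomogeneous_monomial w s r rfl).mul (ht 1)
      · rw [add_comm (Finsupp.weight w s), add_assoc]
        exact (isWeightedHomogeneous_monomial w t 1 rfl).mul (hs r)
    have hzero : ∀ r : K, IsWeightedHomogeneous w (D (Fin 1) (monomial 0 r))
        (Finsupp.weight w (0 : Fin 1 × ℕ →₀ ℕ) + 1) := by
      intro r
      rw [show D (Fin 1) (monomial 0 r) = 0 from D_C r]
      exact isWeightedHomogeneous_zero K w _
    induction s using Finsupp.induction_linear with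
    | zero => exact hzero
    | add s t hs ht => exact hadd s t hs ht
    | single p m =>
      induction m with
      | zero => rw [Finsupp.single_zero]; exact hzero
      | succ m ih =>
        rw [Finsupp.single_add]
        refine hadd _ _ ih fun r => ?_
        rw [show monomial (Finsupp.single p 1) r = C r * X p by
          rw [X, C_mul_monomial, mul_one], Derivation.leibniz, D_C, smul_zero, add_zero,
          totalDeriv_X, smul_eq_mul, Finsupp.weight_single, one_smul]
        have := (isWeightedHomogeneous_X K w (p.1, p.2 + 1)).C_mul r
        convert this using 1
  rw [f.as_sum, map_sum]
  refine IsWeightedHomogeneous.sum _ _ _ fun s hs => ?_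
  rw [← hf (mem_support_iff.1 hs)]
  exact key _ _

theorem isWeightedHomogeneous_kdvSeq (n : ℕ) :
    IsWeightedHomogeneous (fun p : Fin 1 × ℕ => p.2 + 2) (kdvSeq n : Jet K (Fin 1)) (2 * n) := by
  induction n using Nat.strong_induction_on with
  | _ n ih =>
    cases n with
    | zero => rw [kdvSeq_zero]; exact isWeightedHomogeneous_C _ _
    | succ n =>
      rw [kdvSeq_succ]
      refine (IsWeightedHomogeneous.sum _ _ _ fun i hi => ?_).sub
        (IsWeightedHomogeneous.sum _ _ _ fun i hi => ?_)
      · rw [Finset.mem_range] at hi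
        have h1 := ih i hi
        have h2 := ih (n - i) (by omega)
        have h4 : (4 : Jet K (Fin 1)) = C 4 := (map_ofNat C 4).symm
        rw [kdvQuad, h4]
        refine IsWeightedHomogeneous.add (IsWeightedHomogeneous.sub (IsWeightedHomogeneous.add
          ?_ ?_) ?_) ?_
        · convert h1.mul (isWeightedHomogeneous_D (isWeightedHomogeneous_D h2)) using 1; omega
        · convert (isWeightedHomogeneous_D (isWeightedHomogeneous_D h1)).mul h2 using 1; omega
        · convert (isWeightedHomogeneous_D h1).mul (isWeightedHomogeneous_D h2) using 1; omega
        · have e : 0 + 2 + 2 * i + 2 * (n - i) = 2 * (n + 1) := by omega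
          rw [← e]
          exact (((isWeightedHomogeneous_X K _ ((0 : Fin 1), 0)).C_mul 4).mul h1).mul h2
      · rw [Finset.mem_range] at hi
        convert (ih (i + 1) (by omega)).mul (ih (n - i) (by omega)) using 1
        omega

theorem hasRank_firstOrderOp (α : K) (n : ℕ) : HasRank (firstOrderOp α (kdvSeq n)) (2 * n + 1) := by
  intro s m hm
  have h2 : (2 : Jet K (Fin 1)) = C 2 := (map_ofNat C 2).symm
  rw [firstOrderOp, Finsupp.add_apply, h2] at hm
  match s with
  | 0 =>
    rw [Finsupp.single_eq_same, Finsupp.single_eq_of_ne (by simp), add_zero, smul_eq_C_mul] at hm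
    rw [add_zero]
    exact (isWeightedHomogeneous_D (isWeightedHomogeneous_kdvSeq n)).C_mul α hm
  | 1 =>
    rw [Finsupp.single_eq_same, Finsupp.single_eq_of_ne (by simp), zero_add] at hm
    rw [(isWeightedHomogeneous_kdvSeq n).C_mul 2 hm]
  | s + 2 =>
    rw [Finsupp.single_eq_of_ne (by simp), Finsupp.single_eq_of_ne (by simp)] at hm
    simp at hm

end Rank

/-! ### The centralizer of `X_2^ext` -/

section Centralizer

variable {K : Type*} [Field K]

theorem pderiv_iterate_D {ι : Type*} (i : ι) {a : ℕ} {F : Jet K ι}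
    (hF : ∀ p, a < p → pderiv (i, p) F = 0) (j : ℕ) :
    (∀ p, a + j < p → pderiv (i, p) ((D ι)^[j] F) = 0) ∧
      pderiv (i, a + j) ((D ι)^[j] F) = pderiv (i, a) F := by
  induction j with
  | zero => exact ⟨hF, rfl⟩
  | succ j ih =>
    rw [Function.iterate_succ_apply']
    refine ⟨fun p hp => ?_, ?_⟩
    · obtain ⟨p, rfl⟩ : ∃ q, p = q + 1 := ⟨p - 1, by omega⟩
      rw [pderiv_totalDeriv_succ, ih.1 p (by omega), ih.1 (p + 1) (by omega), map_zero, add_zero]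
    · rw [← add_assoc, pderiv_totalDeriv_succ, ih.1 (a + j + 1) (by omega), map_zero, zero_add,
        ih.2]

/-- The right-hand side of the KdV equation. -/
noncomputable def kdvRHS (K : Type*) [Field K] : Jet K (Fin 1) :=
  D (Fin 1) (3 * X (0, 0) ^ 2 + X (0, 2))

theorem kdvRHS_eq : kdvRHS K = 6 * X (0, 0) * X (0, 1) + X (0, 3) := by
  simp only [kdvRHS, sq, map_add, Derivation.leibniz, smul_eq_mul, totalDeriv_X, D_ofNat 3]
  ring

theorem pderiv_kdvRHS (p : ℕ) (hp : 3 ≤ p) :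
    pderiv (0, p) (kdvRHS K) = if p = 3 then 1 else 0 := by
  have h6 : (6 : Jet K (Fin 1)) = C 6 := (map_ofNat C 6).symm
  rw [kdvRHS_eq, h6, map_add, mul_assoc, pderiv_C_mul, pderiv_mul,
    pderiv_X_of_ne (by simp; omega), pderiv_X_of_ne (by simp; omega)]
  split_ifs with h
  · subst h; simp
  · rw [pderiv_X_of_ne (by simp; omega)]; simp

variable [CharZero K]

/-- If `f` has order `m`, the term `u_xxx` of KdV makes the left side of `hf` depend on `u^{(m+3)}`
with coefficient `∂f/∂u^{(m)} ≠ 0`. The right side has order at most `max(m+1, 1)`. -/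
theorem eq_C_of_evol_kdvRHS {f a b : Jet K (Fin 1)}
    (ha : ∀ n, 2 ≤ n → pderiv (0, n) a = 0) (hb : ∀ n, 2 ≤ n → pderiv (0, n) b = 0)
    (hf : evol (0 : Derivation K K K) (fun _ => kdvRHS K) f = a * D (Fin 1) f + b * f) :
    f = C (constantCoeff f) := by
  refine eq_C_of_pderiv_eq_zero fun ⟨i, n⟩ => ?_
  obtain rfl := Subsingleton.elim i 0
  by_contra hn
  obtain ⟨m, hm, hm'⟩ := exists_order ⟨n, hn⟩
  have hG : ∀ p, 3 < p → pderiv (0, p) (kdvRHS K) = 0 := fun p hp => by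
    rw [pderiv_kdvRHS p (by omega), if_neg (by omega)]
  -- Both sides are derivations, so it suffices to compare them on the variables of `f`, all of
  -- order at most `m`.
  have h1 : ⁅pderiv (R := K) ((0 : Fin 1), m + 3),
      evol (0 : Derivation K K K) (fun _ => kdvRHS K)⁆ f = pderiv (0, m) f := by
    refine derivation_eq_of_forall_mem_vars fun ⟨i, q⟩ hq => ?_
    obtain rfl := Subsingleton.elim i 0
    have hqm : q ≤ m := by
      by_contra hqm
      obtain ⟨s, hs, hsq⟩ := (mem_vars_iff_mem_support _).1 hq
      exact mem_support_iff.1 hs (coeff_eq_zero_of_pderiv_eq_zero (hm' q (by omega))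
        (Finsupp.mem_support_iff.1 hsq))
    have h0 : evol (0 : Derivation K K K) (fun _ => kdvRHS K)
        (pderiv ((0 : Fin 1), m + 3) (X (0, q))) = 0 := by
      rw [pderiv_X_of_ne (by simp; omega), map_zero]
    rw [Derivation.commutator_apply, h0, sub_zero, evol_X]
    rcases hqm.eq_or_lt with rfl | hlt
    · rw [add_comm q 3, (pderiv_iterate_D 0 hG q).2, pderiv_kdvRHS 3 le_rfl, if_pos rfl,
        pderiv_X_self]
    · rw [(pderiv_iterate_D 0 hG q).1 (m + 3) (by omega), pderiv_X_of_ne (by simp; omega)]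
  rw [Derivation.commutator_apply, hm' (m + 3) (by omega), map_zero, sub_zero, hf, map_add,
    pderiv_mul, pderiv_mul, ha _ (by omega), hb _ (by omega), pderiv_totalDeriv_succ,
    hm' (m + 3) (by omega), hm' (m + 2) (by omega)] at h1
  refine hm (h1.symm.trans ?_)
  simp

/-- The `φ`-component of `X_2^ext`. -/
noncomputable def extRHS (α : K) : Jet K (Fin 2) :=
  algebraMap K _ α * X (0, 1) * X (1, 0) + 2 * X (0, 0) * X (1, 1)

omit [CharZero K] in
theorem applyPhi_firstOrderOp_X (α : K) :
    applyPhi (firstOrderOp α (X (0, 0))) = extRHS α := by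
  rw [applyPhi_firstOrderOp, inclU_X, totalDeriv_X]
  rfl

omit [CharZero K] in
theorem pderiv_iterate_extRHS (α : K) (s : ℕ) :
    (∀ p, s + 1 < p → pderiv (1, p) ((D (Fin 2))^[s] (extRHS α)) = 0) ∧
      pderiv (1, s + 1) ((D (Fin 2))^[s] (extRHS α)) = 2 * X (0, 0) ∧
      pderiv (1, s) ((D (Fin 2))^[s] (extRHS α)) =
        algebraMap K _ α * X (0, 1) + 2 * (s : Jet K (Fin 2)) * X (0, 1) := by
  have h2 : (2 : Jet K (Fin 2)) = C 2 := (map_ofNat C 2).symm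
  have hα : algebraMap K (Jet K (Fin 2)) α = C α := rfl
  have hX : ∀ (p q : ℕ), pderiv (1, p) (X (0, q) : Jet K (Fin 2)) = 0 :=
    fun p q => pderiv_X_of_ne (by simp)
  have hW : ∀ p, pderiv (1, p) (extRHS α) = algebraMap K _ α * X (0, 1) * pderiv (1, p) (X (1, 0))
      + 2 * X (0, 0) * pderiv (1, p) (X (1, 1)) := by
    intro p
    rw [extRHS, hα, h2, map_add, mul_assoc, mul_assoc, pderiv_C_mul, pderiv_C_mul, pderiv_mul,
      pderiv_mul, hX, hX]
    ring
  have hW2 : ∀ p, 1 < p → pderiv (1, p) (extRHS α) = 0 := by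
    intro p hp
    rw [hW, pderiv_X_of_ne (by simp; omega), pderiv_X_of_ne (by simp; omega)]
    ring
  have hW1 : pderiv (1, 1) (extRHS α) = 2 * X (0, 0) := by
    rw [hW, pderiv_X_of_ne (by simp), pderiv_X_self]
    ring
  have hs := fun s => pderiv_iterate_D (1 : Fin 2) hW2 s
  refine ⟨fun p hp => (hs s).1 p (by omega), ?_, ?_⟩
  · rw [add_comm, (hs s).2, hW1]
  · induction s with
    | zero =>
      rw [Function.iterate_zero, id, hW, pderiv_X_self, pderiv_X_of_ne (by simp)]
      simp
    | succ s ih =>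
      rw [Function.iterate_succ_apply', pderiv_totalDeriv_succ, ih, add_comm s 1, (hs s).2, hW1]
      simp only [Derivation.leibniz, smul_eq_mul, totalDeriv_X]
      rw [show totalDeriv (0 : Derivation K K K) (2 : Jet K (Fin 2)) = 0 from
        Derivation.map_natCast _ 2]
      push_cast
      ring

omit [CharZero K] in
/-- The coefficient of the highest possible derivative `φ^{(N)}` in the `φ`-component of the
commutator of `X_2^ext` with `φ_t = f φ^{(s)}`. -/
theorem pderiv_commutator_monomial (α : K) (f : Jet K (Fin 1)) {s N : ℕ} (hs : s ≤ N) :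
    pderiv (1, N) (evol (0 : Derivation K K K) ![inclU (kdvRHS K), extRHS α] (inclU f * X (1, s))
      - (algebraMap K _ α * X (0, 1) * (inclU f * X (1, s))
        + 2 * X (0, 0) * D (Fin 2) (inclU f * X (1, s)))) =
    if s = N then inclU (evol (0 : Derivation K K K) (fun _ => kdvRHS K) f
      - 2 * X (0, 0) * D (Fin 1) f + 2 * (N : Jet K (Fin 1)) * X (0, 1) * f) else 0 := by
  have h2 : (2 : Jet K (Fin 2)) = C 2 := (map_ofNat C 2).symm
  have hα : algebraMap K (Jet K (Fin 2)) α = C α := rfl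
  have hX : ∀ (p q : ℕ), pderiv (1, p) (X (0, q) : Jet K (Fin 2)) = 0 :=
    fun p q => pderiv_X_of_ne (by simp)
  have hp2 : ∀ p, pderiv (1, p) (2 : Jet K (Fin 2)) = 0 := fun p => by rw [h2, pderiv_C]
  have hpα : ∀ p, pderiv (1, p) (algebraMap K (Jet K (Fin 2)) α) = 0 := fun p => pderiv_C
  have e : evol (0 : Derivation K K K) ![inclU (kdvRHS K), extRHS α] (inclU f * X (1, s)) =
      inclU f * (D (Fin 2))^[s] (extRHS α)
        + inclU (evol (0 : Derivation K K K) (fun _ => kdvRHS K) f) * X (1, s) := by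
    rw [Derivation.leibniz, evol_X, evol_inclU, smul_eq_mul, smul_eq_mul, mul_comm (X (1, s))]
    rfl
  rw [e, Derivation.leibniz, ← inclU_D, totalDeriv_X]
  simp only [map_add, map_sub, pderiv_mul, smul_eq_mul, pderiv_one_inclU, hX, hp2, hpα, zero_mul,
    mul_zero, zero_add, add_zero]
  obtain ⟨h3, h4, h5⟩ := pderiv_iterate_extRHS α s
  rcases hs.eq_or_lt with rfl | hlt
  · rw [h5, if_pos rfl, pderiv_X_self, pderiv_X_of_ne (by simp)]
    simp only [map_mul, map_natCast, map_ofNat, inclU_X]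
    ring
  · rw [if_neg hlt.ne]
    rcases (Nat.succ_le_iff.2 hlt).eq_or_lt with rfl | hlt'
    · rw [h4, pderiv_X_self, pderiv_X_of_ne (by simp)]
      ring
    · rw [h3 N (by omega), pderiv_X_of_ne (by simp; omega), pderiv_X_of_ne (by simp; omega)]
      ring

omit [CharZero K] in
-- With `u_t = 0` in the second system, the `u`-component of the commutator vanishes automatically;
-- only the `φ`-component is a condition.
theorem lie_extKdV₂_linExt_zero_eq_zero_iff (α : K) (S : DiffOp K) :
    ⁅extKdV₂ α, linExt 0 S⁆ = 0 ↔
      evol (0 : Derivation K K K) ![inclU (kdvRHS K), extRHS α] (applyPhi S)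
      - (algebraMap K _ α * X (0, 1) * applyPhi S + 2 * X (0, 0) * D (Fin 2) (applyPhi S)) = 0 := by
  rw [extKdV₂, linExt, linExt, lie_evol, evol_eq_zero_iff, funext_iff, Fin.forall_fin_two,
    applyPhi_firstOrderOp_X]
  have h0 : evol (0 : Derivation K K K) (fun _ => 0) (kdvRHS K) = 0 := by
    rw [show (fun _ : Fin 1 => (0 : Jet K (Fin 1))) = 0 from rfl, (evol_eq_zero_iff _ _).2 rfl]
    rfl
  have h1 : evol (0 : Derivation K K K) ![inclU 0, applyPhi S] (extRHS α) =
      algebraMap K _ α * X (0, 1) * applyPhi S + 2 * X (0, 0) * D (Fin 2) (applyPhi S) := by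
    have e2 : evol (0 : Derivation K K K) ![0, applyPhi S] (2 : Jet K (Fin 2)) = 0 :=
      Derivation.map_natCast _ 2
    simp only [extRHS, map_add, Derivation.leibniz, smul_eq_mul, evol_algebraMap, evol_X_zero,
      evol_X_one, Matrix.cons_val_zero, Matrix.cons_val_one, map_zero, e2]
    ring
  simp only [Matrix.cons_val_zero, Matrix.cons_val_one, Pi.zero_apply, h1]
  refine ⟨fun h => h.2, fun h => ⟨?_, h⟩⟩
  rw [map_zero, map_zero, zero_sub, neg_eq_zero]
  have h2 := evol_inclU 0 (kdvRHS K) (applyPhi S)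
  rw [map_zero] at h2
  exact h2.trans (by rw [h0, map_zero])

theorem lie_extKdV₂_linExt_zero (α : K) (S : DiffOp K) :
    ⁅extKdV₂ α, linExt 0 S⁆ = 0 ↔ ∃ c : K, S = Finsupp.single 0 (C c) := by
  rw [lie_extKdV₂_linExt_zero_eq_zero_iff]
  constructor
  · intro h
    rcases eq_or_ne S 0 with rfl | hS
    · exact ⟨0, by simp⟩
    have hne : S.support.Nonempty := Finsupp.support_nonempty_iff.2 hS
    set N := S.support.max' hne with hN
    have hNS : N ∈ S.support := Finset.max'_mem _ _
    have hle : ∀ s ∈ S.support, s ≤ N := fun s hs => Finset.le_max' _ _ hs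
    -- With `N` the order of `S` and `f` its leading coefficient, the coefficient of `φ^{(N)}` says
    -- `X_KdV(f) = 2u ∂f - 2N u_x f`.
    have h1 := congrArg (pderiv (1, N)) h
    rw [show applyPhi S = ∑ s ∈ S.support, inclU (S s) * X (1, s) from rfl] at h1
    simp only [map_sum, Finset.mul_sum, ← Finset.sum_add_distrib, ← Finset.sum_sub_distrib] at h1
    rw [Finset.sum_congr rfl fun s hs => pderiv_commutator_monomial α (S s) (hle s hs),
      Finset.sum_ite_eq' S.support N, if_pos hNS, map_zero, ← map_zero inclU] at h1
    have h2 := injective_inclU h1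
    have h20 : ∀ n : ℕ, pderiv (R := K) ((0 : Fin 1), n) 2 = 0 := fun n =>
      Derivation.map_natCast _ 2
    have hN0 : ∀ n, pderiv (R := K) ((0 : Fin 1), n) (N : Jet K (Fin 1)) = 0 := fun n =>
      Derivation.map_natCast _ N
    have h3 : S N = C (constantCoeff (S N)) := by
      refine eq_C_of_evol_kdvRHS (a := 2 * X (0, 0)) (b := -(2 * (N : Jet K (Fin 1)) * X (0, 1)))
        (fun n hn => ?_) (fun n hn => ?_) (by linear_combination h2)
      · rw [pderiv_mul, h20, pderiv_X_of_ne (by simp; omega)]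
        simp
      · rw [map_neg, pderiv_mul, pderiv_mul, h20, hN0, pderiv_X_of_ne (by simp; omega)]
        simp
    have hSN : S N ≠ 0 := Finsupp.mem_support_iff.1 hNS
    rw [h3, D_C, show evol (0 : Derivation K K K) (fun _ => kdvRHS K)
      (C (constantCoeff (S N))) = 0 from derivation_C _ _, ← h3] at h2
    -- For constant leading coefficient only `2N u_x f = 0` remains, which forces `N = 0`.
    have h4 : (((2 * N : ℕ) : Jet K (Fin 1)) * X (0, 1)) * S N = 0 := by
      push_cast
      linear_combination h2
    have h5 : N = 0 := by
      rcases mul_eq_zero.1 ((mul_eq_zero.1 h4).resolve_right hSN) with h5 | h5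
      · have := Nat.cast_eq_zero.1 h5
        omega
      · exact absurd h5 (X_ne_zero _)
    refine ⟨constantCoeff (S N), ?_⟩
    rw [← h3, h5]
    ext1 s
    rcases eq_or_ne s 0 with rfl | hs
    · rw [Finsupp.single_eq_same]
    · rw [Finsupp.single_eq_of_ne hs]
      by_contra h6
      have := hle s (Finsupp.mem_support_iff.2 h6)
      omega
  · rintro ⟨c, rfl⟩
    rw [applyPhi_single, inclU_C, Derivation.leibniz, Derivation.leibniz, D_C,
      show evol (0 : Derivation K K K) ![inclU (kdvRHS K), extRHS α] (C c) = 0 from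
      derivation_C _ _, evol_X_zero, totalDeriv_X]
    simp only [Matrix.cons_val_one, Matrix.cons_val_zero, smul_eq_mul, extRHS]
    ring

omit [CharZero K] in
theorem linExt_add (G G' : Jet K (Fin 1)) (R R' : DiffOp K) :
    linExt (G + G') (R + R') = linExt G R + linExt G' R' := by
  rw [linExt, linExt, linExt, ← evol_add, applyPhi_add, map_add]
  congr 1
  ext1 i
  fin_cases i <;> rfl

omit [CharZero K] in
theorem linExt_smul (a : K) (G : Jet K (Fin 1)) (R : DiffOp K) :
    linExt (a • G) (a • R) = a • linExt G R := by
  have hit : ∀ (n : ℕ) (F : Jet K (Fin 2)), (D (Fin 2))^[n] (a • F) = a • (D (Fin 2))^[n] F := by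
    intro n F
    induction n with
    | zero => rfl
    | succ n ih => rw [Function.iterate_succ_apply', ih, Derivation.map_smul,
        Function.iterate_succ_apply']
  have hR : applyPhi (a • R) = a • applyPhi R := by
    rw [applyPhi, applyPhi, Finsupp.sum_smul_index' (by simp), Finsupp.smul_sum]
    refine Finsupp.sum_congr fun s _ => ?_
    rw [map_smul, smul_mul_assoc]
  refine derivation_ext fun ⟨i, n⟩ => ?_
  rw [Derivation.smul_apply, linExt, linExt, evol_X, evol_X, ← hit, map_smul, hR]
  fin_cases i <;> rfl

omit [CharZero K] in
theorem derivation_lie_add {A : Type*} [CommRing A] [Algebra K A] (X Y Z : Derivation K A A) :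
    ⁅X, Y + Z⁆ = ⁅X, Y⁆ + ⁅X, Z⁆ := lie_add X Y Z

omit [CharZero K] in
theorem derivation_lie_smul {A : Type*} [CommRing A] [Algebra K A] (a : K)
    (X Y : Derivation K A A) : ⁅X, a • Y⁆ = a • ⁅X, Y⁆ := lie_smul a X Y

omit [CharZero K] in
theorem derivation_lie_zero {A : Type*} [CommRing A] [Algebra K A]
    (X : Derivation K A A) : ⁅X, (0 : Derivation K A A)⁆ = 0 := lie_zero X

theorem lie_extKdV₂_sum (α : K) (c : ℕ →₀ K) :
    ⁅extKdV₂ α, linExt (c.sum fun n a => a • D (Fin 1) (kdvSeq (n + 1)))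
      (c.sum fun n a => a • firstOrderOp α (kdvSeq n))⁆ = 0 := by
  induction c using Finsupp.induction_linear with
  | zero =>
    rw [Finsupp.sum_zero_index, Finsupp.sum_zero_index]
    have := linExt_smul (0 : K) 0 0
    rw [smul_zero, smul_zero, zero_smul] at this
    rw [this, derivation_lie_zero]
  | add c c' h h' =>
    rw [Finsupp.sum_add_index' (by simp) (by simp [add_smul]),
      Finsupp.sum_add_index' (by simp) (by simp [add_smul]), linExt_add,
      derivation_lie_add, h, h', add_zero]
  | single n a =>
    rw [Finsupp.sum_single_index (by simp), Finsupp.sum_single_index (by simp), linExt_smul,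
      ← extKdV_one,
      derivation_lie_smul]
    exact (congrArg (a • ·) (lie_extKdV α 1 n)).trans (smul_zero a)

theorem lie_extKdV₂_linExt (α : K) (c : ℕ →₀ K) (R : DiffOp K) :
    ⁅extKdV₂ α, linExt (c.sum fun n a => a • D (Fin 1) (kdvSeq (n + 1))) R⁆ = 0 ↔
      ∃ c₀ : K, R = (c.sum fun n a => a • firstOrderOp α (kdvSeq n)) +
        Finsupp.single 0 (C c₀) := by
  set G : Jet K (Fin 1) := c.sum fun n a => a • D (Fin 1) (kdvSeq (n + 1))
  set R₀ : DiffOp K := c.sum fun n a => a • firstOrderOp α (kdvSeq n)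
  have h1 : linExt G R = linExt G R₀ + linExt 0 (R - R₀) := by
    rw [← linExt_add, add_zero, add_sub_cancel]
  rw [h1, derivation_lie_add, lie_extKdV₂_sum, zero_add, lie_extKdV₂_linExt_zero]
  simp only [sub_eq_iff_eq_add, add_comm R₀]

theorem lie_extKdV₂_linExt_of_hasRank (α : K) (c : ℕ →₀ K) (R : ℕ → DiffOp K)
    (hR : ∀ n ∈ c.support, HasRank (R n) (2 * n + 1)) :
    ⁅extKdV₂ α, linExt (c.sum fun n a => a • D (Fin 1) (kdvSeq (n + 1)))
      (∑ n ∈ c.support, R n)⁆ = 0 ↔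
    ∀ n ∈ c.support, R n = c n • firstOrderOp α (kdvSeq n) := by
  rw [lie_extKdV₂_linExt]
  constructor
  · rintro ⟨c₀, h⟩ n hn
    have hA : ∀ n, HasRank (c n • firstOrderOp α (kdvSeq n)) (2 * n + 1) := fun n s m hm => by
      refine hasRank_firstOrderOp α n s m fun h0 => hm ?_
      rw [Finsupp.smul_apply, coeff_smul, h0, smul_zero]
    ext1 s
    ext1 m
    -- Compare coefficients monomial by monomial. The ranks `2n + 1` differ for different `n`, so a
    -- monomial of this rank sees only the index `n` in both sums.
    by_cases hr : Finsupp.weight (fun p : Fin 1 × ℕ => p.2 + 2) m + s = 2 * n + 1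
    · have h1 := congrArg (fun S : DiffOp K => coeff m (S s)) h
      rw [Finsupp.sum] at h1
      simp only [Finsupp.finsetSum_apply, Finsupp.add_apply, coeff_sum, coeff_add] at h1
      rw [Finset.sum_eq_single_of_mem n hn, Finset.sum_eq_single_of_mem n hn] at h1
      · rw [h1]
        convert add_zero _
        -- The free constant `c₀` has rank zero and cannot contribute in the odd rank `2n + 1`.
        rcases eq_or_ne s 0 with rfl | hs
        · rw [Finsupp.single_eq_same, coeff_C, if_neg]
          rintro rfl
          simp at hr
        · rw [Finsupp.single_eq_of_ne hs, coeff_zero]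
      · intro b _ hb
        by_contra h0
        have := hA b s m h0
        omega
      · intro b hb' hb
        by_contra h0
        have := hR b hb' s m h0
        omega
    · have h1 : coeff m (R n s) = 0 := by
        by_contra h0
        exact hr (hR n hn s m h0)
      have h2 : coeff m ((c n • firstOrderOp α (kdvSeq n)) s) = 0 := by
        by_contra h0
        exact hr (hA n s m h0)
      rw [h1, h2]
  · intro h
    exact ⟨0, by rw [C_0, Finsupp.single_zero, add_zero, Finsupp.sum, Finset.sum_congr rfl h]⟩

theorem lie_extKdV₂_linExt_eq_extKdV (α : K) (n : ℕ) (R : DiffOp K) (hR : HasRank R (2 * n + 1)) :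
    ⁅extKdV₂ α, linExt (D (Fin 1) (kdvSeq (n + 1))) R⁆ = 0 ↔
      linExt (D (Fin 1) (kdvSeq (n + 1))) R = extKdV α kdvSeq n := by
  have hs : (Finsupp.single n (1 : K)).support = {n} := Finsupp.support_single _ one_ne_zero
  have h := lie_extKdV₂_linExt_of_hasRank α (Finsupp.single n 1) (fun _ => R) (by simpa [hs])
  rw [Finsupp.sum_single_index (by simp), hs] at h
  simp only [Finset.sum_singleton, Finset.mem_singleton, forall_eq, one_smul,
    Finsupp.single_eq_same] at h
  constructor
  · intro h0
    rw [h.1 h0, extKdV]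
  -- The hypothesis equates derivations, not operators, so commutativity of the flows is used
  -- directly.
  · intro h0
    rw [h0, ← extKdV_one]
    exact lie_extKdV α 1 n

end Centralizer

end KdVExt

theorem mainTheorem10 {K : Type*} [Field K] [CharZero K] (α : K) :
    -- the differential polynomials `h_n` exist and are unique
    (∃! h : ℕ → KdVExt.Jet K (Fin 1), KdVExt.IsKdVSequence h) ∧
    -- the matrix is Hamiltonian, being twice the sum of the linear matrix of `D₁ ⋉ V^λ`,
    -- `λ = 1 - α/2`, and of a generalized 2-cocycle on `D₁`
    (∀ (k : Type*) [CommRing k] [Algebra K k] (d : Derivation K k k),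
      KdVExt.extMatrix d α = (2 : K) • (KdVExt.linMatrix d (1 - α / 2) + KdVExt.constMatrix d) ∧
      KdVExt.CorrespondsToSemiDir d (1 - α / 2) (KdVExt.linMatrix d (1 - α / 2)) ∧
      (∀ x y : KdVExt.SemiDir d (1 - α / 2),
        ∑ i, KdVExt.coords x i * KdVExt.matApply (KdVExt.constMatrix d) (KdVExt.coords y) i =
          MvPolynomial.C (KdVExt.gfForm d x.right y.right)) ∧
      KdVExt.IsGenCocycle d (KdVExt.gfForm d) ∧
      KdVExt.IsHamiltonian d (KdVExt.extMatrix d α)) ∧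
    ∀ h : ℕ → KdVExt.Jet K (Fin 1), KdVExt.IsKdVSequence h →
      -- the extended flows are Hamiltonian in this matrix, with commuting Hamiltonians
      (∃ H : ℕ → KdVExt.Jet K (Fin 1),
        (∀ n, KdVExt.varDeriv (0 : Derivation K K K) (H n) 0 = h n) ∧
        (∀ m n, KdVExt.EqModDiv (0 : Derivation K K K)
          (KdVExt.bracket 0 (KdVExt.kdvMatrix (0 : Derivation K K K)) (H m) (H n)) 0) ∧
        ∀ n, KdVExt.extKdV α h n =
          KdVExt.hamField 0 (KdVExt.extMatrix (0 : Derivation K K K) α) (KdVExt.inclU (H n))) ∧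
      -- the extended flows commute
      (∀ m n, ⁅KdVExt.extKdV α h m, KdVExt.extKdV α h n⁆ = 0) ∧
      -- they exhaust the centralizer of `X_2^ext` among linear extensions of KdV flows
      KdVExt.extKdV α h 1 = KdVExt.extKdV₂ α ∧
      (∀ (c : ℕ →₀ K) (R : KdVExt.DiffOp K),
        ⁅KdVExt.extKdV₂ α,
          KdVExt.linExt (c.sum fun n a => a • KdVExt.D (Fin 1) (h (n + 1))) R⁆ = 0 ↔
        ∃ c₀ : K, R = (c.sum fun n a => a • KdVExt.firstOrderOp α (h n)) +
          Finsupp.single 0 (MvPolynomial.C c₀)) ∧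
      (∀ (c : ℕ →₀ K) (R : ℕ → KdVExt.DiffOp K),
        (∀ n ∈ c.support, KdVExt.HasRank (R n) (2 * n + 1)) →
        (⁅KdVExt.extKdV₂ α,
          KdVExt.linExt (c.sum fun n a => a • KdVExt.D (Fin 1) (h (n + 1)))
            (∑ n ∈ c.support, R n)⁆ = 0 ↔
        ∀ n ∈ c.support, R n = c n • KdVExt.firstOrderOp α (h n))) ∧
      (∀ (n : ℕ) (R : KdVExt.DiffOp K), KdVExt.HasRank R (2 * n + 1) →
        (⁅KdVExt.extKdV₂ α, KdVExt.linExt (KdVExt.D (Fin 1) (h (n + 1))) R⁆ = 0 ↔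
          KdVExt.linExt (KdVExt.D (Fin 1) (h (n + 1))) R = KdVExt.extKdV α h n)) := by
  refine ⟨⟨KdVExt.kdvSeq, KdVExt.isKdVSequence_kdvSeq, fun h hh => hh.eq_kdvSeq⟩,
    fun k _ _ d => ⟨KdVExt.extMatrix_eq d α, KdVExt.correspondsToSemiDir_linMatrix d _,
      KdVExt.coords_constMatrix d _, KdVExt.isGenCocycle_gfForm d,
      KdVExt.isHamiltonian_extMatrix d α⟩, fun h hh => ?_⟩
  obtain rfl := hh.eq_kdvSeq
  exact ⟨⟨KdVExt.kdvHam, KdVExt.varDeriv_kdvHam, KdVExt.bracket_kdvHam,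
      KdVExt.extKdV_eq_hamField α⟩, KdVExt.lie_extKdV α, KdVExt.extKdV_one α,
    KdVExt.lie_extKdV₂_linExt α, KdVExt.lie_extKdV₂_linExt_of_hasRank α,
    KdVExt.lie_extKdV₂_linExt_eq_extKdV α⟩
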